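/- Let $R$ be a commutative Noetherian ring, let $C$ be a semidualizing $R$-module, i.e. a finitely generated $R$-module such that the homothety map $R\to\operatorname{Hom}_R(C,C)$ is an isomorphism and $\operatorname{Ext}^i_R(C,C)=0$ for all $i>0$. For a finitely generated $R$-module $N$ put $\operatorname{grade}_R(N)=\inf\{i \mid \operatorname{Ext}^i_R(N,R)\neq 0\}$; this equals $\inf\{i\mid \operatorname{Ext}^i_R(N,C)\ne 0\}$. For an integer $j\geq 0$ let $\mathcal G_C^j$ be the class of finitely generated $R$-modules $N$ with $\operatorname{grade}_R(N)=j$ such that $\operatorname{Ext}_R^{j+i}(N,C)=0$ and $\operatorname{Ext}_R^{j+i}(\operatorname{Ext}_R^j(N,C),C)=0$ for all $i>0$, and such that the natural map $\delta_C^j(N)\colon N\to\operatorname{Ext}_R^j(\operatorname{Ext}_R^j(N,C),C)$ is an isomorphism. For a finitely generated $R$-module $N$ with $\operatorname{grade}_R(N)\ge j$, the $G_C^j$-dimension $\mathrm G_C^j\text{-}\dim_R(N)$ is the least $n$ for which there is an exact sequence $0\to N_n\to\cdots\to N_1\to N_0\to N\to 0$ with all $N_k\in\mathcal G_C^j$,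 and $\infty$ if there is no such sequence for any $n$. (Here $\delta_C^0(N)$ is evaluation. For $j>0$ take a projective resolution $P_\bullet\to N$ and let $Z^j$ be the module of cocycles in $\operatorname{Hom}_R(P_j,C)$; then $\delta_C^j(N)$ sends the image in $N$ of $p\in P_0$ to the pushforward along the evaluation $\operatorname{Hom}_R(P_0,C)\to C$ at $p$ of the Yoneda class of the exact sequence $0\to\operatorname{Hom}_R(P_0,C)\to\cdots\to\operatorname{Hom}_R(P_{j-1},C)\to Z^j\to\operatorname{Ext}_R^j(N,C)\to0$.) Let $M$ be a nonzero finitely generated $R$-module and $g=\operatorname{grade}_R(M)$, which is finite. Then for every integer $i$ with $0\le i\leq g$, $$\mathrm G_C^i\text{-}\dim_R(M)<\infty\quad\Longleftrightarrow\quad \mathrm G_C^{g}\text{-}\dim_R(M)<\infty .$$ -/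

import Mathlib

open CategoryTheory

universe u

namespace GCDim

noncomputable section

variable {R : Type u} [CommRing R]

/-- The grade `inf {i | Ext^i(M, N) ≠ 0}` of `M` with respect to `N`; it is `⊤` if all
`Ext^i(M, N)` vanish. -/
def gradeWith (N M : ModuleCat.{u} R) : ℕ∞ :=
  ⨅ (i : ℕ) (_ : Nontrivial (Abelian.Ext M N i)), (i : ℕ∞)

/-- `grade_R(M) = inf {i | Ext^i(M, R) ≠ 0}`. -/
def grade (M : ModuleCat.{u} R) : ℕ∞ := gradeWith (ModuleCat.of R R) M

/-- A semidualizing module: finitely generated, the homothety map `R → Hom(C, C)` is an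
isomorphism, and `Ext^i(C, C) = 0` for `i > 0`. -/
structure IsSemidualizing (C : ModuleCat.{u} R) : Prop where
  finite : Module.Finite R C
  homothety_bijective : Function.Bijective (LinearMap.lsmul R C)
  ext_eq_zero : ∀ i : ℕ, 0 < i → Subsingleton (Abelian.Ext C C i)

/-! ### Short exact sequences of images -/

/-- If `A → B → D` is exact at `B`, the sequence `0 → im f → B → im g → 0`. -/
abbrev rangeSES {A B D : Type u} [AddCommGroup A] [AddCommGroup B] [AddCommGroup D]
    [Module R A] [Module R B] [Module R D] (f : A →ₗ[R] B) (g : B →ₗ[R] D)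
    (h : Function.Exact f g) : ShortComplex (ModuleCat.{u} R) :=
  ShortComplex.mk (X₁ := ModuleCat.of R (LinearMap.range f)) (X₂ := ModuleCat.of R B)
    (X₃ := ModuleCat.of R (LinearMap.range g))
    (ModuleCat.ofHom (LinearMap.range f).subtype) (ModuleCat.ofHom g.rangeRestrict) (by
      refine ModuleCat.hom_ext (LinearMap.ext ?_)
      rintro ⟨_, a, rfl⟩
      exact Subtype.ext (h.apply_apply_eq_zero a))

lemma rangeSES_shortExact {A B D : Type u} [AddCommGroup A] [AddCommGroup B] [AddCommGroup D]
    [Module R A] [Module R B] [Module R D] (f : A →ₗ[R] B) (g : B →ₗ[R] D)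
    (h : Function.Exact f g) : (rangeSES f g h).ShortExact := by
  refine ModuleCat.shortComplex_shortExact _ ?_ ?_ ?_
  · intro b
    refine ⟨fun hb => ?_, ?_⟩
    · obtain ⟨a, ha⟩ := (h b).1 (congrArg Subtype.val hb)
      exact ⟨⟨b, a, ha⟩, rfl⟩
    · rintro ⟨⟨_, a, rfl⟩, rfl⟩
      exact Subtype.ext (h.apply_apply_eq_zero a)
  · exact Subtype.val_injective
  · exact g.surjective_rangeRestrict

/-! ### The dual of a projective resolution -/

variable {M : ModuleCat.{u} R} (P : ProjectiveResolution M) (C : ModuleCat.{u} R)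

/-- The differential `Hom(P_k, C) → Hom(P_{k+1}, C)`. -/
def dualD (k : ℕ) : (P.complex.X k ⟶ C) →ₗ[R] (P.complex.X (k + 1) ⟶ C) :=
  Linear.leftComp R C (P.complex.d (k + 1) k)

/-- The map sending a cocycle in `Hom(P_n, C)` to its class in `Ext^n(M, C)`. -/
def cocycleToExt (n : ℕ) : LinearMap.ker (dualD P C n) →ₗ[R] Abelian.Ext M C n where
  toFun f := P.extMk f.1 (n + 1) rfl f.2
  map_add' f g := (P.add_extMk f.1 g.1 (n + 1) rfl f.2 g.2).symm
  map_smul' r f := by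
    refine Eq.trans ?_ ((Abelian.Ext.smul_eq_comp_mk₀ _ r).trans
      (P.extMk_comp_mk₀ f.1 (n + 1) rfl f.2 (r • 𝟙 C))).symm
    simp

lemma cocycleToExt_surjective (n : ℕ) : Function.Surjective (cocycleToExt P C n) := by
  intro α
  obtain ⟨f, hf, h⟩ := P.extMk_surjective α (n + 1) rfl
  exact ⟨⟨f, hf⟩, h⟩

lemma dualD_comp (k : ℕ) (f : P.complex.X k ⟶ C) : dualD P C (k + 1) (dualD P C k f) = 0 := by
  simp [dualD]

/-- The inclusion of the coboundaries in `Hom(P_{n+1}, C)` into the cocycles. -/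
def boundaryToCocycle (n : ℕ) :
    LinearMap.range (dualD P C n) →ₗ[R] LinearMap.ker (dualD P C (n + 1)) :=
  Submodule.inclusion (by rintro _ ⟨f, rfl⟩; exact dualD_comp P C n f)

lemma cocycleToExt_eq_zero_iff (n : ℕ) (f : LinearMap.ker (dualD P C (n + 1))) :
    cocycleToExt P C (n + 1) f = 0 ↔ f ∈ Set.range (boundaryToCocycle P C n) := by
  refine (P.extMk_eq_zero_iff f.1 (n + 2) rfl f.2 n rfl).trans ⟨?_, ?_⟩
  · rintro ⟨g, hg⟩
    exact ⟨⟨_, g, rfl⟩, Subtype.ext hg⟩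
  · rintro ⟨⟨_, g, rfl⟩, rfl⟩
    exact ⟨g, rfl⟩

/-- `0 → (coboundaries) → (cocycles) → Ext^{n+1}(M, C) → 0`. -/
abbrev extSES (n : ℕ) : ShortComplex (ModuleCat.{u} R) :=
  ShortComplex.mk (X₁ := ModuleCat.of R (LinearMap.range (dualD P C n)))
    (X₂ := ModuleCat.of R (LinearMap.ker (dualD P C (n + 1))))
    (X₃ := ModuleCat.of R (Abelian.Ext M C (n + 1)))
    (ModuleCat.ofHom (boundaryToCocycle P C n)) (ModuleCat.ofHom (cocycleToExt P C (n + 1))) (by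
      ext f
      exact (cocycleToExt_eq_zero_iff P C n _).2 ⟨f, rfl⟩)

lemma extSES_shortExact (n : ℕ) : (extSES P C n).ShortExact :=
  ModuleCat.shortComplex_shortExact _ (cocycleToExt_eq_zero_iff P C n)
    (fun _ _ h => Subtype.ext (congrArg
      (fun z : LinearMap.ker (dualD P C (n + 1)) => z.1) h)) (cocycleToExt_surjective P C (n + 1))

/-- The dual complex is exact in degrees in which `Ext` vanishes. -/
lemma dualD_exact (k : ℕ) (h : Subsingleton (Abelian.Ext M C (k + 1))) :
    Function.Exact (dualD P C k) (dualD P C (k + 1)) := by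
  intro f
  refine ⟨fun hf => ?_, ?_⟩
  · exact (P.extMk_eq_zero_iff f (k + 2) rfl hf k rfl).1 (Subsingleton.elim _ _)
  · rintro ⟨g, rfl⟩
    exact dualD_comp P C k g

/-- The augmentation `P_0 → M`. -/
def augmentation : P.complex.X 0 →ₗ[R] M := (P.π.f 0).hom

lemma augmentation_surjective : Function.Surjective (augmentation P) :=
  (ModuleCat.epi_iff_surjective _).1 (inferInstanceAs (Epi (P.π.f 0)))

lemma augmentation_exact : Function.Exact (P.complex.d 1 0).hom (augmentation P) := by
  exact (ShortComplex.ShortExact.moduleCat_exact_iff_function_exact _).1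
    (ShortComplex.exact_of_g_is_cokernel
      (ShortComplex.mk (P.complex.d 1 0) (P.π.f 0) P.complex_d_comp_π_f_zero)
      P.isColimitCokernelCofork)

lemma dualD_zero_injective (h : Subsingleton (Abelian.Ext M C 0)) :
    Function.Injective (dualD P C 0) := by
  rw [← LinearMap.ker_eq_bot, LinearMap.ker_eq_bot']
  intro f hf
  obtain ⟨φ, hφ⟩ := Limits.CokernelCofork.IsColimit.desc' P.isColimitCokernelCofork f hf
  have : φ = 0 := (Abelian.Ext.mk₀_eq_zero_iff (M := M) φ).1 (h.elim _ _)
  rw [← hφ, this, Limits.comp_zero]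

/-! ### The natural map `M → Ext^g(Ext^g(M, C), C)` -/

/-- If `Ext^i(M, C) = 0` for `1 ≤ i ≤ n`, the dual complex `Hom(P, C)` is exact in degrees
`1, …, n`, and this is the Yoneda class of the exact sequence
`0 → im d^0 → Hom(P_1, C) → ⋯ → Hom(P_n, C) → im d^n → 0`
(with `d^k : Hom(P_k, C) → Hom(P_{k+1}, C)`). -/
def yonedaClass : (n : ℕ) → (∀ i < n, Subsingleton (Abelian.Ext M C (i + 1))) →
    Abelian.Ext (ModuleCat.of R (LinearMap.range (dualD P C n)))
      (ModuleCat.of R (LinearMap.range (dualD P C 0))) n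
  | 0, _ => Abelian.Ext.mk₀ (𝟙 _)
  | n + 1, h =>
    (rangeSES_shortExact _ _ (dualD_exact P C n (h n n.lt_succ_self))).extClass.comp
      (yonedaClass n fun i hi => h i (hi.trans n.lt_succ_self)) (Nat.add_comm 1 n)

/-- If `Ext^i(M, C) = 0` for `1 ≤ i ≤ n`, the Yoneda class of the exact sequence
`0 → im d^0 → Hom(P_1, C) → ⋯ → Hom(P_n, C) → Z^{n+1} → Ext^{n+1}(M, C) → 0`,
where `Z^{n+1} ⊆ Hom(P_{n+1}, C)` is the module of cocycles. -/
def yonedaExtClass (n : ℕ) (h : ∀ i < n, Subsingleton (Abelian.Ext M C (i + 1))) :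
    Abelian.Ext (ModuleCat.of R (Abelian.Ext M C (n + 1)))
      (ModuleCat.of R (LinearMap.range (dualD P C 0))) (n + 1) :=
  (extSES_shortExact P C n).extClass.comp (yonedaClass P C n h) (Nat.add_comm 1 n)

/-- Evaluation at `p ∈ P_k`, as a map `Hom(P_k, C) → C`. -/
def evalAt (k : ℕ) : P.complex.X k →ₗ[R] (P.complex.X k ⟶ C) →ₗ[R] C :=
  LinearMap.mk₂ R (fun p f => f.hom p) (fun _ _ _ => by simp) (fun _ _ _ => by simp)
    (fun _ _ _ => by simp) (fun _ _ _ => by simp)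

/-- If `Hom(M, C) = 0`, the differential identifies `Hom(P_0, C)` with its image in
`Hom(P_1, C)`; under this identification, evaluation at `p ∈ P_0` is a map `im d^0 → C`. -/
def evalRange (h₀ : Subsingleton (Abelian.Ext M C 0)) :
    P.complex.X 0 →ₗ[R] LinearMap.range (dualD P C 0) →ₗ[R] C :=
  LinearMap.lcomp R C
    (LinearEquiv.ofInjective (dualD P C 0) (dualD_zero_injective P C h₀)).symm.toLinearMap ∘ₗ
      evalAt P C 0

/-- The map `P_0 → Ext^{n+1}(Ext^{n+1}(M, C), C)` which sends `p` to the pushforward of the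
Yoneda class of `0 → Hom(P_0, C) → ⋯ → Hom(P_n, C) → Z^{n+1} → Ext^{n+1}(M, C) → 0` along the
evaluation `Hom(P_0, C) → C` at `p`. -/
def bidualityLift (n : ℕ) (h : ∀ i < n + 1, Subsingleton (Abelian.Ext M C i)) :
    P.complex.X 0 →ₗ[R]
      Abelian.Ext (ModuleCat.of R (Abelian.Ext M C (n + 1))) C (n + 1) :=
  (yonedaExtClass P C n fun i hi => h (i + 1) (Nat.succ_lt_succ hi)).precompOfLinear R C
      (Nat.add_zero (n + 1)) ∘ₗ
    (Abelian.Ext.linearEquiv₀ (R := R)).symm.toLinearMap ∘ₗ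
    (ModuleCat.homLinearEquiv (S := R)).symm.toLinearMap ∘ₗ
    evalRange P C (h 0 n.succ_pos)

lemma bidualityLift_apply (n : ℕ) (h : ∀ i < n + 1, Subsingleton (Abelian.Ext M C i))
    (p : P.complex.X 0) :
    bidualityLift P C n h p =
      (yonedaExtClass P C n fun i hi => h (i + 1) (Nat.succ_lt_succ hi)).comp
        (Abelian.Ext.mk₀ (ModuleCat.ofHom (evalRange P C (h 0 n.succ_pos) p)))
        (Nat.add_zero (n + 1)) := rfl

lemma evalRange_d (h₀ : Subsingleton (Abelian.Ext M C 0)) (q : P.complex.X 1) :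
    evalRange P C h₀ ((P.complex.d 1 0).hom q) =
      evalAt P C 1 q ∘ₗ (LinearMap.range (dualD P C 0)).subtype := by
  ext ⟨_, f, rfl⟩
  have : (LinearEquiv.ofInjective (dualD P C 0) (dualD_zero_injective P C h₀)).symm
      ⟨dualD P C 0 f, f, rfl⟩ = f :=
    (LinearEquiv.ofInjective _ _).symm_apply_apply f
  change ((LinearEquiv.ofInjective (dualD P C 0) (dualD_zero_injective P C h₀)).symm
      ⟨dualD P C 0 f, f, rfl⟩).hom ((P.complex.d 1 0).hom q) = _
  rw [this]
  rfl

lemma yonedaClass_comp_eval (n : ℕ)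
    (h : ∀ i < n + 1, Subsingleton (Abelian.Ext M C (i + 1))) (q : P.complex.X 1) :
    (yonedaClass P C (n + 1) h).comp (Abelian.Ext.mk₀ (ModuleCat.ofHom
      (evalAt P C 1 q ∘ₗ (LinearMap.range (dualD P C 0)).subtype))) (Nat.add_zero (n + 1)) =
      0 := by
  induction n with
  | zero =>
    have hS := rangeSES_shortExact _ _ (dualD_exact P C 0 (h 0 Nat.one_pos))
    change (hS.extClass.comp (Abelian.Ext.mk₀ (𝟙 _)) _).comp _ _ = 0
    rw [Abelian.Ext.comp_mk₀_id]
    have : (ModuleCat.ofHom (evalAt P C 1 q ∘ₗ (LinearMap.range (dualD P C 0)).subtype)) =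
        (rangeSES _ _ (dualD_exact P C 0 (h 0 Nat.one_pos))).f ≫
          ModuleCat.ofHom (evalAt P C 1 q) := rfl
    rw [this, ← Abelian.Ext.mk₀_comp_mk₀]
    exact hS.extClass_comp_assoc _
  | succ n ih =>
    rw [yonedaClass, Abelian.Ext.comp_assoc_of_third_deg_zero, ih, Abelian.Ext.comp_zero]

lemma bidualityLift_d (n : ℕ) (h : ∀ i < n + 1, Subsingleton (Abelian.Ext M C i))
    (q : P.complex.X 1) : bidualityLift P C n h ((P.complex.d 1 0).hom q) = 0 := by
  rw [bidualityLift_apply, evalRange_d]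
  cases n with
  | zero =>
    change ((extSES_shortExact P C 0).extClass.comp (Abelian.Ext.mk₀ (𝟙 _)) _).comp _ _ = 0
    rw [Abelian.Ext.comp_mk₀_id]
    have : (ModuleCat.ofHom (evalAt P C 1 q ∘ₗ (LinearMap.range (dualD P C 0)).subtype)) =
        (extSES P C 0).f ≫
          ModuleCat.ofHom (evalAt P C 1 q ∘ₗ (LinearMap.ker (dualD P C 1)).subtype) := rfl
    rw [this, ← Abelian.Ext.mk₀_comp_mk₀]
    exact (extSES_shortExact P C 0).extClass_comp_assoc _
  | succ n =>
    rw [yonedaExtClass, Abelian.Ext.comp_assoc_of_third_deg_zero, yonedaClass_comp_eval,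
      Abelian.Ext.comp_zero]

/-- The natural map `δ_C^g(M) : M → Ext^g(Ext^g(M, C), C)`, for a module `M` with
`Ext^i(M, C) = 0` for `i < g`, computed with a projective resolution `P` of `M`.

For `g = 0` it is the evaluation map `M → Hom(Hom(M, C), C)`. For `g > 0`, it sends the image in
`M` of `p ∈ P_0` to the pushforward, along the evaluation `Hom(P_0, C) → C` at `p`, of the Yoneda
class of the exact sequence
`0 → Hom(P_0, C) → ⋯ → Hom(P_{g-1}, C) → Z^g → Ext^g(M, C) → 0`,
where `Z^g ⊆ Hom(P_g, C)` is the module of cocycles. -/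
def biduality : (g : ℕ) → (∀ i < g, Subsingleton (Abelian.Ext M C i)) →
    (M →ₗ[R] Abelian.Ext (ModuleCat.of R (Abelian.Ext M C g)) C g)
  | 0, _ =>
    (Abelian.Ext.linearEquiv₀ (R := R)).symm.toLinearMap ∘ₗ
    (ModuleCat.homLinearEquiv (S := R)).symm.toLinearMap ∘ₗ
    LinearMap.flip ((ModuleCat.homLinearEquiv (S := R)).toLinearMap ∘ₗ
      (Abelian.Ext.linearEquiv₀ (R := R)).toLinearMap)
  | n + 1, h =>
    (LinearMap.ker (augmentation P)).liftQ (bidualityLift P C n h) (by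
      intro p hp
      obtain ⟨q, rfl⟩ := (augmentation_exact P p).1 hp
      exact bidualityLift_d P C n h q) ∘ₗ
    ((augmentation P).quotKerEquivOfSurjective (augmentation_surjective P)).symm.toLinearMap

lemma biduality_augmentation (n : ℕ) (h : ∀ i < n + 1, Subsingleton (Abelian.Ext M C i))
    (p : P.complex.X 0) :
    biduality P C (n + 1) h (augmentation P p) = bidualityLift P C n h p := by
  have : ((augmentation P).quotKerEquivOfSurjective (augmentation_surjective P)).symm
      (augmentation P p) = Submodule.Quotient.mk p :=
    (LinearEquiv.symm_apply_eq _).2 rfl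
  rw [biduality, LinearMap.comp_apply, LinearEquiv.coe_coe, this]
  rfl

/-! The natural map does not depend on the projective resolution. -/

section independence

variable {P C} {P' : ProjectiveResolution M} (φ : ProjectiveResolution.Hom P' P (𝟙 M))

/-- The map between the images of the dual differentials induced by a map of resolutions. -/
def rangeMap (k : ℕ) :
    LinearMap.range (dualD P C k) →ₗ[R] LinearMap.range (dualD P' C k) :=
  (Linear.leftComp R C (φ.hom.f (k + 1))).restrict (by
    rintro _ ⟨f, rfl⟩
    exact ⟨φ.hom.f k ≫ f, by simp [dualD]⟩)

/-- The map between the modules of cocycles induced by a map of resolutions. -/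
def cocycleMap (k : ℕ) :
    LinearMap.ker (dualD P C k) →ₗ[R] LinearMap.ker (dualD P' C k) :=
  (Linear.leftComp R C (φ.hom.f k)).restrict (by
    intro f hf
    have hf : P.complex.d (k + 1) k ≫ f = 0 := hf
    change P'.complex.d (k + 1) k ≫ φ.hom.f k ≫ f = 0
    simp [← φ.hom.comm_assoc, hf])

lemma cocycleToExt_cocycleMap (n : ℕ) (f : LinearMap.ker (dualD P C n)) :
    cocycleToExt P' C n (cocycleMap φ n f) = cocycleToExt P C n f :=
  (ProjectiveResolution.mk₀_comp_extMk f.1 (n + 1) rfl f.2 φ).symm.trans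
    (Abelian.Ext.mk₀_id_comp _)

lemma yonedaClass_naturality (n : ℕ) (h : ∀ i < n, Subsingleton (Abelian.Ext M C (i + 1))) :
    (yonedaClass P C n h).comp (Abelian.Ext.mk₀ (ModuleCat.ofHom (rangeMap φ 0)))
        (Nat.add_zero n) =
      (Abelian.Ext.mk₀ (ModuleCat.ofHom (rangeMap φ n))).comp (yonedaClass P' C n h)
        (Nat.zero_add n) := by
  induction n with
  | zero => simp [yonedaClass]
  | succ n ih =>
    have hS := rangeSES_shortExact _ _ (dualD_exact P C n (h n n.lt_succ_self))
    have hS' := rangeSES_shortExact _ _ (dualD_exact P' C n (h n n.lt_succ_self))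
    let ψ : rangeSES _ _ (dualD_exact P C n (h n n.lt_succ_self)) ⟶
        rangeSES _ _ (dualD_exact P' C n (h n n.lt_succ_self)) :=
      { τ₁ := ModuleCat.ofHom (rangeMap φ n)
        τ₂ := ModuleCat.ofHom (Linear.leftComp R C (φ.hom.f (n + 1)))
        τ₃ := ModuleCat.ofHom (rangeMap φ (n + 1))
        comm₁₂ := rfl
        comm₂₃ := by
          refine ModuleCat.hom_ext (LinearMap.ext fun f => Subtype.ext ?_)
          change P'.complex.d _ _ ≫ φ.hom.f _ ≫ f = φ.hom.f _ ≫ P.complex.d _ _ ≫ f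
          simp }
    have nat := hS.extClass_naturality hS' ψ
    rw [yonedaClass, yonedaClass, Abelian.Ext.comp_assoc_of_third_deg_zero, ih,
      ← Abelian.Ext.comp_assoc_of_second_deg_zero,
      ← Abelian.Ext.comp_assoc _ _ _ (Nat.zero_add 1) (Nat.add_comm 1 n) (by omega)]
    exact congrArg (fun z => Abelian.Ext.comp z _ _) nat

lemma yonedaExtClass_naturality (n : ℕ)
    (h : ∀ i < n, Subsingleton (Abelian.Ext M C (i + 1))) :
    (yonedaExtClass P C n h).comp (Abelian.Ext.mk₀ (ModuleCat.ofHom (rangeMap φ 0)))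
      (Nat.add_zero (n + 1)) = yonedaExtClass P' C n h := by
  let ψ : extSES P C n ⟶ extSES P' C n :=
    { τ₁ := ModuleCat.ofHom (rangeMap φ n)
      τ₂ := ModuleCat.ofHom (cocycleMap φ (n + 1))
      τ₃ := 𝟙 _
      comm₁₂ := rfl
      comm₂₃ := ModuleCat.hom_ext (LinearMap.ext fun f => cocycleToExt_cocycleMap φ (n + 1) f) }
  have nat := (extSES_shortExact P C n).extClass_naturality (extSES_shortExact P' C n) ψ
  have nat' : (extSES_shortExact P C n).extClass.comp
      (Abelian.Ext.mk₀ (ModuleCat.ofHom (rangeMap φ n))) (Nat.add_zero 1) =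
      (extSES_shortExact P' C n).extClass := nat.trans (Abelian.Ext.mk₀_id_comp _)
  rw [yonedaExtClass, yonedaExtClass, Abelian.Ext.comp_assoc_of_third_deg_zero,
    yonedaClass_naturality, ← Abelian.Ext.comp_assoc_of_second_deg_zero]
  exact congrArg (fun z => Abelian.Ext.comp z _ _) nat'

lemma evalRange_naturality (h₀ : Subsingleton (Abelian.Ext M C 0)) (p : P'.complex.X 0) :
    evalRange P' C h₀ p ∘ₗ rangeMap φ 0 = evalRange P C h₀ ((φ.hom.f 0).hom p) := by
  ext ⟨_, f, rfl⟩
  have h1 : (LinearEquiv.ofInjective (dualD P C 0) (dualD_zero_injective P C h₀)).symm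
      ⟨dualD P C 0 f, f, rfl⟩ = f :=
    (LinearEquiv.ofInjective _ _).symm_apply_apply f
  have h2 : (LinearEquiv.ofInjective (dualD P' C 0) (dualD_zero_injective P' C h₀)).symm
      (rangeMap φ 0 ⟨dualD P C 0 f, f, rfl⟩) = φ.hom.f 0 ≫ f := by
    rw [LinearEquiv.symm_apply_eq]
    apply Subtype.ext
    change φ.hom.f 1 ≫ P.complex.d 1 0 ≫ f = P'.complex.d 1 0 ≫ φ.hom.f 0 ≫ f
    simp
  change ((LinearEquiv.ofInjective (dualD P' C 0) (dualD_zero_injective P' C h₀)).symm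
      (rangeMap φ 0 ⟨dualD P C 0 f, f, rfl⟩)).hom p =
    ((LinearEquiv.ofInjective (dualD P C 0) (dualD_zero_injective P C h₀)).symm
      ⟨dualD P C 0 f, f, rfl⟩).hom _
  rw [h1, h2]
  rfl

end independence

/-- The natural map computed with two projective resolutions is the same. -/
theorem biduality_eq (P P' : ProjectiveResolution M) (g : ℕ)
    (h : ∀ i < g, Subsingleton (Abelian.Ext M C i)) :
    biduality P C g h = biduality P' C g h := by
  cases g with
  | zero => rfl
  | succ n =>
    let φ : ProjectiveResolution.Hom P' P (𝟙 M) :=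
      { hom := ProjectiveResolution.lift (𝟙 M) P' P
        hom_f_zero_comp_π_f_zero := ProjectiveResolution.lift_commutes_zero _ _ _ }
    refine LinearMap.ext fun m => ?_
    obtain ⟨p, rfl⟩ := augmentation_surjective P' m
    have hp : augmentation P' p = augmentation P ((φ.hom.f 0).hom p) := by
      have := congrArg (fun f => f.hom p) φ.hom_f_zero_comp_π_f_zero
      exact (this.trans rfl).symm
    rw [biduality_augmentation, hp, biduality_augmentation, bidualityLift_apply,
      bidualityLift_apply, ← evalRange_naturality φ, ModuleCat.ofHom_comp,
      ← Abelian.Ext.mk₀_comp_mk₀, ← Abelian.Ext.comp_assoc_of_third_deg_zero,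
      yonedaExtClass_naturality]

/-- The natural map `δ_C^g(M) : M → Ext^g(Ext^g(M, C), C)` of a module `M` with `Ext^i(M, C) = 0`
for `i < g` (computed with any projective resolution of `M`, see `biduality_eq`). -/
def delta (C : ModuleCat.{u} R) (g : ℕ) (M : ModuleCat.{u} R)
    (h : ∀ i < g, Subsingleton (Abelian.Ext M C i)) :
    M →ₗ[R] Abelian.Ext (ModuleCat.of R (Abelian.Ext M C g)) C g :=
  biduality (projectiveResolution M) C g h

/-! ### Intermediate `C`-Gorenstein dimensions -/

/-- The class `𝒢_C^g` of finitely generated modules of `G_C^g`-dimension zero. -/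
structure IsGCZero (C : ModuleCat.{u} R) (g : ℕ) (M : ModuleCat.{u} R) : Prop where
  finite : Module.Finite R M
  grade_eq : grade M = g
  ext_eq_zero : ∀ i : ℕ, 0 < i → Subsingleton (Abelian.Ext M C (g + i))
  ext_ext_eq_zero : ∀ i : ℕ, 0 < i →
    Subsingleton (Abelian.Ext (ModuleCat.of R (Abelian.Ext M C g)) C (g + i))
  /-- The map `δ_C^g(M)` is defined and is an isomorphism. Over a Noetherian ring, the vanishing
  of `Ext^i(M, C)` for `i < g` is automatic if `C` is semidualizing and `grade M = g`, as then
  `gradeWith C M = grade M`. -/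
  delta_bijective : ∃ h : ∀ i < g, Subsingleton (Abelian.Ext M C i),
    Function.Bijective (delta C g M h)

/-- A `G_C^j`-resolution `0 → X_n → ⋯ → X_1 → X_0 → M → 0` of `M`: an exact sequence with
`X_0, …, X_n` in `𝒢_C^j` (continued by zero modules). -/
structure GCResolution (C : ModuleCat.{u} R) (j : ℕ) (M : ModuleCat.{u} R) (n : ℕ) where
  X : ℕ → ModuleCat.{u} R
  d : ∀ k, X (k + 1) →ₗ[R] X k
  ε : X 0 →ₗ[R] M
  surjective : Function.Surjective ε
  exact_zero : Function.Exact (d 0) ε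
  exact_succ : ∀ k, Function.Exact (d (k + 1)) (d k)
  isGCZero : ∀ k ≤ n, IsGCZero C j (X k)
  eq_zero : ∀ k, n < k → Subsingleton (X k)

/-- The `j`-th intermediate `C`-Gorenstein dimension `G_C^j-dim_R(M)`: the least `n` for which
there is a `G_C^j`-resolution `0 → X_n → ⋯ → X_0 → M → 0`, and `⊤` if there is none. -/
def gcDim (C : ModuleCat.{u} R) (j : ℕ) (M : ModuleCat.{u} R) : ℕ∞ :=
  ⨅ (n : ℕ) (_ : Nonempty (GCResolution C j M n)), (n : ℕ∞)

end

end GCDim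

/-! For every `i ≤ grade M`, finiteness of the `G_C^i`-dimension is equivalent to a condition that
does not involve `i`: `M` has a finite resolution by totally `C`-reflexive modules (`HasFinDim`).
This is `gcDim_lt_top_iff_hasFinDim`; the theorem is its use for `i` and for `g`.

From left to right, let `K` lie in `𝒢_C^j` with `j = n + 1`, let `P` be a resolution of `K` by
finite free modules and `S` the `j`-th syzygy. As `Ext^l(K, C) = 0` for `l < j`, dualizing gives an
exact sequence `0 → P_0^* → ⋯ → P_n^* → S^* → Ext^j(K, C) → 0`, and `δ` is its iterated connecting
map composed with evaluation. Dimension shifting along it shows that `S` is totally reflexive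
(`totRefl_syzygy`), so `K` has a finite totally reflexive resolution. Two-out-of-three for
`HasFinDim` (`IsSES.finDim_aux`) extends this to every module with a finite resolution by such `K`.

From right to left, `i ≤ grade M` provides a sequence of length `i` in the annihilator of `M`,
regular on both `R` and `C`, generating an ideal `J`. The quotient `T = R/J` has finite dimension
and `Ext^l(T, C) = 0` for `l > i` (`exists_isPerfectQuotient`). Cover `M` by a power of `T`, then
the kernel, and so on: each step lowers by one the degree above which `Ext(-, C)` vanishes, until it
is `i`. A module `K` killed by `J`, with a nonzero map to `T`, of finite dimension and with
`Ext^l(K, C) = 0` for `l > i`, lies in `𝒢_C^i` (`IsPerfectQuotient.isGCZero`): its `i`-th syzygy is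
totally reflexive, and the dimension shifting runs backwards (`biduality_bijective`,
`extVanish_ext`). -/

namespace GCDim

variable {R : Type u} [CommRing R]

/-! ### Short exact sequences and `Ext` -/

/-- `0 → A → B → D → 0` is a short exact sequence. -/
structure IsSES {A B D : Type*} [AddCommGroup A] [AddCommGroup B] [AddCommGroup D]
    [Module R A] [Module R B] [Module R D] (f : A →ₗ[R] B) (g : B →ₗ[R] D) : Prop where
  inj : Function.Injective f
  exact : Function.Exact f g
  surj : Function.Surjective g

lemma isSES_ker {B D : Type*} [AddCommGroup B] [AddCommGroup D] [Module R B] [Module R D]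
    {g : B →ₗ[R] D} (hg : Function.Surjective g) : IsSES (LinearMap.ker g).subtype g :=
  ⟨Subtype.val_injective, LinearMap.exact_subtype_ker_map g, hg⟩

variable {A B D : Type u} [AddCommGroup A] [AddCommGroup B] [AddCommGroup D]
  [Module R A] [Module R B] [Module R D] {f : A →ₗ[R] B} {g : B →ₗ[R] D}

/-- The short exact sequence, as a short complex of `ModuleCat R`. -/
abbrev IsSES.sc (h : IsSES f g) : ShortComplex (ModuleCat.{u} R) :=
  ShortComplex.mk (X₁ := ModuleCat.of R A) (X₂ := ModuleCat.of R B) (X₃ := ModuleCat.of R D)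
    (ModuleCat.ofHom f) (ModuleCat.ofHom g)
    (ModuleCat.hom_ext (LinearMap.ext h.exact.apply_apply_eq_zero))

lemma IsSES.shortExact (h : IsSES f g) : h.sc.ShortExact :=
  ModuleCat.shortComplex_shortExact _ h.exact h.inj h.surj

/-- `Ext^n(M, N) = 0`. -/
abbrev ExtVanish (M : Type u) [AddCommGroup M] [Module R M] (N : ModuleCat.{u} R) (n : ℕ) : Prop :=
  Subsingleton (Abelian.Ext (ModuleCat.of R M) N n)

variable {N : ModuleCat.{u} R} {n : ℕ}

lemma ExtVanish.congr (e : A ≃ₗ[R] B) (h : ExtVanish (R := R) A N n) :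
    ExtVanish (R := R) B N n := by
  refine subsingleton_of_forall_eq 0 fun x => ?_
  have h0 : (Abelian.Ext.mk₀ (ModuleCat.ofHom (X := A) (Y := B) e.toLinearMap)).comp x
    (zero_add n) = 0 := Subsingleton.elim _ _
  rw [← Abelian.Ext.mk₀_id_comp x]
  have : (𝟙 (ModuleCat.of R B)) = ModuleCat.ofHom e.symm.toLinearMap ≫
      ModuleCat.ofHom e.toLinearMap := by
    ext; simp
  rw [this, ← Abelian.Ext.mk₀_comp_mk₀_assoc, h0, Abelian.Ext.comp_zero]

lemma extVanish_zero_iff {M : Type u} [AddCommGroup M] [Module R M] :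
    ExtVanish (R := R) M N 0 ↔ Subsingleton (M →ₗ[R] N) :=
  (Abelian.Ext.addEquiv₀.trans ModuleCat.homAddEquiv).toEquiv.subsingleton_congr

lemma extVanish_of_subsingleton {M : Type u} [AddCommGroup M] [Module R M] [Subsingleton M]
    (n : ℕ) : ExtVanish (R := R) M N n := by
  refine subsingleton_of_forall_eq 0 fun x => ?_
  rw [← Abelian.Ext.mk₀_id_comp x]
  have : (𝟙 (ModuleCat.of R M)) = 0 := ModuleCat.hom_ext (LinearMap.ext fun m =>
    Subsingleton.elim (α := M) _ _)
  rw [this, Abelian.Ext.mk₀_zero, Abelian.Ext.zero_comp]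

lemma extVanish_of_projective {M : Type u} [AddCommGroup M] [Module R M] [Module.Projective R M]
    (hn : 0 < n) : ExtVanish (R := R) M N n := by
  obtain ⟨n, rfl⟩ := Nat.exists_eq_succ_of_ne_zero hn.ne'
  have := (IsProjective.iff_projective (R := R) M).1 inferInstance
  exact Abelian.Ext.subsingleton_of_projective _ _ _

namespace IsSES

variable (h : IsSES f g)
include h

lemma ext_mid (hA : ExtVanish (R := R) A N n) (hD : ExtVanish (R := R) D N n) :
    ExtVanish (R := R) B N n := by
  refine subsingleton_of_forall_eq 0 fun x => ?_
  obtain ⟨y, rfl⟩ := Abelian.Ext.contravariant_sequence_exact₂ h.shortExact N x (hA.elim _ _)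
  rw [hD.elim y 0, Abelian.Ext.comp_zero]

lemma ext_left (hB : ExtVanish (R := R) B N n) (hD : ExtVanish (R := R) D N (n + 1)) :
    ExtVanish (R := R) A N n := by
  refine subsingleton_of_forall_eq 0 fun x => ?_
  obtain ⟨y, rfl⟩ := Abelian.Ext.contravariant_sequence_exact₁ h.shortExact N x
    (add_comm 1 n) (hD.elim _ _)
  rw [hB.elim y 0, Abelian.Ext.comp_zero]

lemma ext_right (hA : ExtVanish (R := R) A N n) (hB : ExtVanish (R := R) B N (n + 1)) :
    ExtVanish (R := R) D N (n + 1) := by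
  refine subsingleton_of_forall_eq 0 fun x => ?_
  obtain ⟨y, rfl⟩ := Abelian.Ext.contravariant_sequence_exact₃ h.shortExact N x
    (hB.elim _ _) (add_comm 1 n)
  rw [hA.elim y 0, Abelian.Ext.comp_zero]

lemma hom_ext_right {N : Type*} [AddCommGroup N] [Module R N] {φ ψ : D →ₗ[R] N}
    (e : φ ∘ₗ g = ψ ∘ₗ g) : φ = ψ :=
  LinearMap.ext fun d => by
    obtain ⟨b, rfl⟩ := h.surj d
    exact LinearMap.congr_fun e b

lemma exists_desc {N : Type*} [AddCommGroup N] [Module R N] (φ : B →ₗ[R] N)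
    (hφ : φ ∘ₗ f = 0) : ∃ ψ : D →ₗ[R] N, ψ ∘ₗ g = φ := by
  refine ⟨(LinearMap.ker g).liftQ φ (fun b hb => ?_) ∘ₗ
    (g.quotKerEquivOfSurjective h.surj).symm.toLinearMap, LinearMap.ext fun b => ?_⟩
  · obtain ⟨a, rfl⟩ := (h.exact b).1 hb
    exact LinearMap.congr_fun hφ a
  · have : (g.quotKerEquivOfSurjective h.surj).symm (g b) = Submodule.Quotient.mk b :=
      (LinearEquiv.symm_apply_eq _).2 rfl
    simp only [LinearMap.comp_apply, LinearEquiv.coe_coe, this]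
    rfl

lemma exists_extend (hφ : ExtVanish (R := R) D N 1) (φ : A →ₗ[R] N) :
    ∃ ψ : B →ₗ[R] N, ψ ∘ₗ f = φ := by
  obtain ⟨y, hy⟩ := Abelian.Ext.contravariant_sequence_exact₁ h.shortExact N
    (Abelian.Ext.mk₀ (ModuleCat.ofHom φ)) (add_zero 1) (hφ.elim _ _)
  obtain ⟨z, rfl⟩ := (Abelian.Ext.mk₀_bijective _ _).2 y
  rw [Abelian.Ext.mk₀_comp_mk₀] at hy
  exact ⟨z.hom, congrArg ModuleCat.Hom.hom ((Abelian.Ext.mk₀_bijective _ _).1 hy)⟩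

/-- Dualizing a short exact sequence. -/
lemma lcomp (hD : ExtVanish (R := R) D N 1) :
    IsSES (LinearMap.lcomp R N g) (LinearMap.lcomp R N f) where
  inj _ _ e := h.hom_ext_right e
  exact φ := by
    refine ⟨fun hφ => h.exists_desc φ hφ, ?_⟩
    rintro ⟨ψ, rfl⟩
    refine LinearMap.ext fun a => ?_
    change ψ (g (f a)) = 0
    rw [h.exact.apply_apply_eq_zero, map_zero]
  surj := h.exists_extend hD

end IsSES

/-! ### Maps between short exact sequences -/

/-- A map of short exact sequences which is bijective on two of the three terms is bijective
on the third one. -/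
lemma IsSES.bijective_mid {A' B' D' : Type*} [AddCommGroup A'] [AddCommGroup B'] [AddCommGroup D']
    [Module R A'] [Module R B'] [Module R D'] {f' : A' →ₗ[R] B'} {g' : B' →ₗ[R] D'}
    (h : IsSES f g) (h' : IsSES f' g') {a : A →ₗ[R] A'} {b : B →ₗ[R] B'} {d : D →ₗ[R] D'}
    (e₁ : ∀ x, b (f x) = f' (a x)) (e₂ : ∀ x, d (g x) = g' (b x))
    (ha : Function.Bijective a) (hd : Function.Bijective d) : Function.Bijective b := by
  constructor
  · refine (injective_iff_map_eq_zero b).2 fun x hx => ?_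
    obtain ⟨y, rfl⟩ := (h.exact x).1 (hd.1 (by rw [e₂, hx, map_zero, map_zero]))
    rw [e₁] at hx
    rw [ha.1 (h'.inj (hx.trans (map_zero _).symm) |>.trans (map_zero a).symm), map_zero]
  · intro y
    obtain ⟨z, hz⟩ := hd.2 (g' y)
    obtain ⟨x, rfl⟩ := h.surj z
    obtain ⟨w, hw⟩ := (h'.exact (y - b x)).1 (by rw [map_sub, ← e₂, hz, sub_self])
    obtain ⟨v, rfl⟩ := ha.2 w
    exact ⟨x + f v, by rw [map_add, e₁, hw]; abel⟩

lemma IsSES.bijective_left {A' B' D' : Type*} [AddCommGroup A'] [AddCommGroup B']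
    [AddCommGroup D'] [Module R A'] [Module R B'] [Module R D'] {f' : A' →ₗ[R] B'}
    {g' : B' →ₗ[R] D'} (h : IsSES f g) (hf' : Function.Injective f')
    (h' : Function.Exact f' g') {a : A →ₗ[R] A'} {b : B →ₗ[R] B'} {d : D →ₗ[R] D'}
    (e₁ : ∀ x, b (f x) = f' (a x)) (e₂ : ∀ x, d (g x) = g' (b x))
    (hb : Function.Bijective b) (hd : Function.Injective d) : Function.Bijective a := by
  constructor
  · refine (injective_iff_map_eq_zero a).2 fun x hx => h.inj (hb.1 ?_)
    rw [e₁, hx, map_zero, map_zero, map_zero]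
  · intro y
    obtain ⟨x, hx⟩ := hb.2 (f' y)
    obtain ⟨z, rfl⟩ := (h.exact x).1 (hd (by
      rw [e₂, hx, h'.apply_apply_eq_zero, map_zero]))
    exact ⟨z, hf' (by rw [← e₁, hx])⟩

lemma IsSES.bijective_right {A' B' D' : Type*} [AddCommGroup A'] [AddCommGroup B']
    [AddCommGroup D'] [Module R A'] [Module R B'] [Module R D'] {f' : A' →ₗ[R] B'}
    {g' : B' →ₗ[R] D'} (h : IsSES f g) (h' : IsSES f' g')
    {a : A →ₗ[R] A'} {b : B →ₗ[R] B'} {d : D →ₗ[R] D'}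
    (e₁ : ∀ x, b (f x) = f' (a x)) (e₂ : ∀ x, d (g x) = g' (b x))
    (ha : Function.Surjective a) (hb : Function.Bijective b) : Function.Bijective d := by
  constructor
  · refine (injective_iff_map_eq_zero d).2 fun x hx => ?_
    obtain ⟨y, rfl⟩ := h.surj x
    rw [e₂] at hx
    obtain ⟨z, hz⟩ := (h'.exact _).1 hx
    obtain ⟨w, rfl⟩ := ha z
    rw [← e₁] at hz
    rw [← hb.1 hz, h.exact.apply_apply_eq_zero]
  · intro y
    obtain ⟨z, rfl⟩ := h'.surj y
    obtain ⟨x, rfl⟩ := hb.2 z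
    exact ⟨g x, e₂ x⟩

/-! ### The covariant long exact sequence -/

lemma IsSES.ext_cov_right {X : ModuleCat.{u} R} (h : IsSES f g)
    (hB : Subsingleton (Abelian.Ext X (ModuleCat.of R B) n))
    (hA : Subsingleton (Abelian.Ext X (ModuleCat.of R A) (n + 1))) :
    Subsingleton (Abelian.Ext X (ModuleCat.of R D) n) := by
  refine subsingleton_of_forall_eq 0 fun x => ?_
  obtain ⟨y, rfl⟩ := Abelian.Ext.covariant_sequence_exact₃ X h.shortExact x rfl (hA.elim _ _)
  rw [hB.elim y 0, Abelian.Ext.zero_comp]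

end GCDim

namespace GCDim

variable {R : Type u} [CommRing R] (C : ModuleCat.{u} R)

/-! ### Totally reflexive modules -/

/-- The evaluation map `X → Hom(Hom(X, C), C)`. -/
def bidualMap (X : Type u) [AddCommGroup X] [Module R X] : X →ₗ[R] (X →ₗ[R] C) →ₗ[R] C :=
  LinearMap.flip LinearMap.id

/-- Totally `C`-reflexive modules. -/
structure TotRefl (X : Type u) [AddCommGroup X] [Module R X] : Prop where
  finite : Module.Finite R X
  ext_eq_zero : ∀ i : ℕ, 0 < i → ExtVanish (R := R) X C i
  dual_ext_eq_zero : ∀ i : ℕ, 0 < i → ExtVanish (R := R) (X →ₗ[R] C) C i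
  bijective : Function.Bijective (bidualMap C X)

variable {C}
variable {A B D : Type u} [AddCommGroup A] [AddCommGroup B] [AddCommGroup D]
  [Module R A] [Module R B] [Module R D]

lemma IsSES.finite_mid {f : A →ₗ[R] B} {g : B →ₗ[R] D} (h : IsSES f g) [Module.Finite R A]
    [Module.Finite R D] : Module.Finite R B := by
  have e : (B ⧸ LinearMap.range f) ≃ₗ[R] D :=
    (Submodule.quotEquivOfEq _ _ (LinearMap.exact_iff.1 h.exact).symm).trans
      (g.quotKerEquivOfSurjective h.surj)
  have : Module.Finite R (B ⧸ LinearMap.range f) := Module.Finite.equiv e.symm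
  exact Module.Finite.of_submodule_quotient (LinearMap.range f)

lemma TotRefl.congr (e : A ≃ₗ[R] B) (h : TotRefl C A) : TotRefl C B where
  finite := have := h.finite; Module.Finite.equiv e
  ext_eq_zero i hi := (h.ext_eq_zero i hi).congr e
  dual_ext_eq_zero i hi := (h.dual_ext_eq_zero i hi).congr (e.congrLeft C R)
  bijective := by
    have : ⇑(bidualMap C B) = (e.congrLeft C R).congrLeft C R ∘ bidualMap C A ∘ e.symm := by
      ext x φ
      change φ x = φ (e (e.symm x))
      rw [e.apply_symm_apply]
    rw [this]
    exact (((e.congrLeft C R).congrLeft C R).bijective.comp h.bijective).comp e.symm.bijective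

lemma totRefl_of_subsingleton [Subsingleton A] : TotRefl C A where
  finite := inferInstance
  ext_eq_zero i _ := extVanish_of_subsingleton i
  dual_ext_eq_zero i _ := extVanish_of_subsingleton i
  bijective := ⟨fun _ _ _ => Subsingleton.elim _ _, fun y => ⟨0, LinearMap.ext fun φ => by
    rw [Subsingleton.elim φ 0, map_zero, map_zero]⟩⟩

lemma bidualMap_naturality (f : A →ₗ[R] B) (a : A) :
    bidualMap C B (f a) = LinearMap.lcomp R C (LinearMap.lcomp R C f) (bidualMap C A a) := rfl

section

variable {f : A →ₗ[R] B} {g : B →ₗ[R] D} (h : IsSES f g)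
include h

lemma IsSES.totRefl_mid (hA : TotRefl C A) (hD : TotRefl C D) : TotRefl C B := by
  have hs := h.lcomp (hD.ext_eq_zero 1 one_pos)
  have hss := hs.lcomp (hA.dual_ext_eq_zero 1 one_pos)
  have := hA.finite
  have := hD.finite
  exact ⟨h.finite_mid, fun i hi => h.ext_mid (hA.ext_eq_zero i hi) (hD.ext_eq_zero i hi),
    fun i hi => hs.ext_mid (hD.dual_ext_eq_zero i hi) (hA.dual_ext_eq_zero i hi),
    h.bijective_mid hss (bidualMap_naturality f) (bidualMap_naturality g)
      hA.bijective hD.bijective⟩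

lemma IsSES.totRefl_left [IsNoetherianRing R] (hB : TotRefl C B) (hD : TotRefl C D) :
    TotRefl C A := by
  have hs := h.lcomp (hD.ext_eq_zero 1 one_pos)
  have := hB.finite
  refine ⟨Module.Finite.of_injective f h.inj,
    fun i hi => h.ext_left (hB.ext_eq_zero i hi) (hD.ext_eq_zero (i + 1) i.succ_pos), ?_, ?_⟩
  · intro i hi
    obtain ⟨i, rfl⟩ := Nat.exists_eq_succ_of_ne_zero hi.ne'
    rcases Nat.eq_zero_or_pos i with rfl | hi
    · refine subsingleton_of_forall_eq 0 fun x => ?_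
      obtain ⟨y, rfl⟩ := Abelian.Ext.contravariant_sequence_exact₃ hs.shortExact C x
        ((hB.dual_ext_eq_zero 1 one_pos).elim _ _) (add_zero 1)
      obtain ⟨z, rfl⟩ := (Abelian.Ext.mk₀_bijective _ _).2 y
      -- A functional on the dual of `D` is evaluation at some `d`; evaluation at a lift of `d` to
      -- `B` extends it to the dual of `B`, so the connecting map kills it.
      obtain ⟨d, hd⟩ := hD.bijective.2 z.hom
      obtain ⟨b, rfl⟩ := h.surj d
      have : z = hs.sc.f ≫ ModuleCat.ofHom (bidualMap C B b) := ModuleCat.hom_ext hd.symm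
      rw [this, ← Abelian.Ext.mk₀_comp_mk₀]
      exact hs.shortExact.extClass_comp_assoc _
    · exact hs.ext_right (hD.dual_ext_eq_zero i hi) (hB.dual_ext_eq_zero (i + 1) i.succ_pos)
  · have hss : Function.Exact (LinearMap.lcomp R C (LinearMap.lcomp R C f))
        (LinearMap.lcomp R C (LinearMap.lcomp R C g)) := by
      intro φ
      refine ⟨fun hφ => hs.exists_desc φ hφ, ?_⟩
      rintro ⟨ψ, rfl⟩
      refine LinearMap.ext fun a => ?_
      change ψ (LinearMap.lcomp R C f (LinearMap.lcomp R C g a)) = 0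
      rw [hs.exact.apply_apply_eq_zero, map_zero]
    exact h.bijective_left (fun _ _ e => hs.hom_ext_right e) hss (bidualMap_naturality f)
      (bidualMap_naturality g) hB.bijective hD.bijective.1

/-- Vanishing of `Ext^1(D, C)` keeps the dual sequence exact, so that the double dual sequence is
exact too and can be compared with the original one. -/
lemma IsSES.totRefl_right (hA : TotRefl C A) (hB : TotRefl C B) (hD : ExtVanish (R := R) D C 1) :
    TotRefl C D := by
  have hs := h.lcomp hD
  have hss := hs.lcomp (hA.dual_ext_eq_zero 1 one_pos)
  have := hB.finite
  refine ⟨Module.Finite.of_surjective g h.surj, ?_, fun i hi => hs.ext_left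
    (hB.dual_ext_eq_zero i hi) (hA.dual_ext_eq_zero (i + 1) i.succ_pos),
    h.bijective_right hss (bidualMap_naturality f) (bidualMap_naturality g)
      hA.bijective.2 hB.bijective⟩
  intro i hi
  obtain ⟨i, rfl⟩ := Nat.exists_eq_succ_of_ne_zero hi.ne'
  rcases Nat.eq_zero_or_pos i with rfl | hi
  · exact hD
  · exact h.ext_right (hA.ext_eq_zero i hi) (hB.ext_eq_zero (i + 1) i.succ_pos)

end

lemma isSES_prod (A B : Type*) [AddCommGroup A] [AddCommGroup B] [Module R A] [Module R B] :
    IsSES (LinearMap.inl R A B) (LinearMap.snd R A B) :=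
  ⟨LinearMap.inl_injective, Function.Exact.inl_snd, LinearMap.snd_surjective⟩

lemma TotRefl.prod (hA : TotRefl C A) (hB : TotRefl C B) : TotRefl C (A × B) :=
  (isSES_prod A B).totRefl_mid hA hB

lemma IsSemidualizing.totRefl_self (hC : IsSemidualizing C) : TotRefl C R where
  finite := inferInstance
  ext_eq_zero _ hi := extVanish_of_projective hi
  dual_ext_eq_zero i hi := ExtVanish.congr (LinearMap.ringLmapEquivSelf R R C).symm
    (hC.ext_eq_zero i hi)
  bijective := by
    have : ⇑(bidualMap C R) = (LinearMap.ringLmapEquivSelf R R C).symm.congrLeft C R ∘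
        LinearMap.lsmul R C := by
      ext r φ
      change φ r = r • φ 1
      rw [← map_smul, smul_eq_mul, mul_one]
    rw [this]
    exact (LinearEquiv.bijective _).comp hC.homothety_bijective

lemma IsSemidualizing.totRefl_pi (hC : IsSemidualizing C) (m : ℕ) : TotRefl C (Fin m → R) := by
  induction m with
  | zero => exact totRefl_of_subsingleton
  | succ m ih =>
    exact (hC.totRefl_self.prod ih).congr (Fin.consLinearEquiv R (fun _ : Fin (m + 1) => R))

/-! ### Modules of finite `C`-Gorenstein dimension -/

variable (C) in
/-- `M` has a resolution of length at most `n` by totally `C`-reflexive modules. -/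
def FinDim : ℕ → (M : Type u) → [AddCommGroup M] → [Module R M] → Prop
  | 0, M, _, _ => TotRefl C M
  | n + 1, M, _, _ => ∃ (X : ModuleCat.{u} R) (p : X →ₗ[R] M), Function.Surjective p ∧
      TotRefl C X ∧ FinDim n (LinearMap.ker p)

lemma FinDim.congr {n : ℕ} (e : A ≃ₗ[R] B) (h : FinDim C n A) : FinDim C n B := by
  cases n with
  | zero => exact TotRefl.congr e h
  | succ n =>
    obtain ⟨X, p, hp, hX, hK⟩ := h
    refine ⟨X, e.toLinearMap ∘ₗ p, e.surjective.comp hp, hX, ?_⟩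
    rw [LinearEquiv.ker_comp]
    exact hK

/-- The kernel of the surjection of a short exact sequence. -/
noncomputable def IsSES.kerEquiv {f : A →ₗ[R] B} {g : B →ₗ[R] D} (h : IsSES f g) :
    A ≃ₗ[R] LinearMap.ker g :=
  (LinearEquiv.ofInjective f h.inj).trans
    (LinearEquiv.ofEq _ _ (LinearMap.exact_iff.1 h.exact).symm)

lemma IsSES.finDim_succ {n : ℕ} {f : A →ₗ[R] B} {g : B →ₗ[R] D} (h : IsSES f g)
    (hA : FinDim C n A) (hB : TotRefl C B) : FinDim C (n + 1) D :=
  ⟨ModuleCat.of R B, g, h.surj, hB, hA.congr h.kerEquiv⟩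

lemma FinDim.succ {n : ℕ} {M : Type u} [AddCommGroup M] [Module R M] (h : FinDim C n M) :
    FinDim C (n + 1) M := by
  induction n generalizing M with
  | zero =>
    refine ⟨ModuleCat.of R M, LinearMap.id, Function.surjective_id, h, ?_⟩
    rw [LinearMap.ker_id]
    exact totRefl_of_subsingleton
  | succ n ih =>
    obtain ⟨X, p, hp, hX, hK⟩ := h
    exact ⟨X, p, hp, hX, ih hK⟩

lemma FinDim.mono {n m : ℕ} (h : FinDim C n A) (hnm : n ≤ m) : FinDim C m A := by
  induction hnm with
  | refl => exact h
  | step _ ih => exact ih.succ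

lemma FinDim.finite {n : ℕ} (h : FinDim C n A) : Module.Finite R A := by
  cases n with
  | zero => exact TotRefl.finite h
  | succ n =>
    obtain ⟨X, p, hp, hX, -⟩ := h
    have := hX.finite
    exact Module.Finite.of_surjective p hp

lemma FinDim.extVanish {n : ℕ} {M : Type u} [AddCommGroup M] [Module R M] (h : FinDim C n M)
    {l : ℕ} (hl : n < l) : ExtVanish (R := R) M C l := by
  induction n generalizing M l with
  | zero => exact TotRefl.ext_eq_zero h l hl
  | succ n ih =>
    obtain ⟨X, p, hp, hX, hK⟩ := h
    obtain ⟨l, rfl⟩ := Nat.exists_eq_succ_of_ne_zero (by omega : l ≠ 0)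
    exact (isSES_ker hp).ext_right (ih hK (by omega)) (hX.ext_eq_zero _ l.succ_pos)

/-- The vanishing passes to the kernel of the first cover, which is totally reflexive by induction;
`Ext^1(M, C) = 0` then transfers the property to the quotient `M`. -/
lemma FinDim.totRefl {n : ℕ} {M : Type u} [AddCommGroup M] [Module R M] (h : FinDim C n M)
    (hM : ∀ l, 0 < l → ExtVanish (R := R) M C l) : TotRefl C M := by
  induction n generalizing M with
  | zero => exact h
  | succ n ih =>
    obtain ⟨X, p, hp, hX, hK⟩ := h
    refine (isSES_ker hp).totRefl_right (ih hK fun l hl => ?_) hX (hM 1 one_pos)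
    exact (isSES_ker hp).ext_left (hX.ext_eq_zero l hl) (hM _ l.succ_pos)

/-- If `g ∘ f` is the composition of two surjections, `0 → ker f → ker (g ∘ f) → ker g → 0`. -/
lemma isSES_ker_comp (f : A →ₗ[R] B) (g : B →ₗ[R] D) (hf : Function.Surjective f) :
    IsSES (Submodule.inclusion (LinearMap.ker_le_ker_comp f g))
      (f.restrict (p := LinearMap.ker (g ∘ₗ f)) (q := LinearMap.ker g) fun _ h => h) where
  inj := Submodule.inclusion_injective _
  exact x := by
    refine ⟨fun hx => ⟨⟨x.1, congrArg Subtype.val hx⟩, rfl⟩, ?_⟩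
    rintro ⟨y, rfl⟩
    exact Subtype.ext y.2
  surj y := by
    obtain ⟨x, hx⟩ := hf y.1
    exact ⟨⟨x, (congrArg g hx).trans y.2⟩, Subtype.ext hx⟩

lemma FinDim.prod {n : ℕ} (hA : FinDim C n A) (hB : TotRefl C B) : FinDim C n (A × B) := by
  cases n with
  | zero => exact TotRefl.prod hA hB
  | succ n =>
    obtain ⟨X, p, hp, hX, hK⟩ := hA
    have : IsSES ((LinearMap.inl R X B) ∘ₗ (LinearMap.ker p).subtype)
        (p.prodMap (LinearMap.id : B →ₗ[R] B)) := by
      refine ⟨LinearMap.inl_injective.comp Subtype.val_injective, ?_,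
        Function.Surjective.prodMap hp Function.surjective_id⟩
      rintro ⟨x, b⟩
      constructor
      · intro h
        obtain ⟨h1, h2⟩ := Prod.ext_iff.1 h
        exact ⟨⟨x, h1⟩, Prod.ext rfl h2.symm⟩
      · rintro ⟨y, hy⟩
        obtain ⟨h1, h2⟩ := Prod.ext_iff.1 hy
        exact Prod.ext ((congrArg p h1.symm).trans y.2) h2.symm
    exact this.finDim_succ hK (hX.prod hB)

/-! ### Pullbacks and splittings -/

/-- The pullback of `b : B → D` and `x : X → D`. -/
abbrev pullback (b : B →ₗ[R] D) (x : A →ₗ[R] D) : Submodule R (B × A) :=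
  LinearMap.eqLocus (b ∘ₗ LinearMap.fst R B A) (x ∘ₗ LinearMap.snd R B A)

lemma isSES_pullback_fst (b : B →ₗ[R] D) {x : A →ₗ[R] D} (hx : Function.Surjective x) :
    IsSES ((LinearMap.inr R B A).restrict (p := LinearMap.ker x) (q := pullback b x)
      fun a (ha : x a = 0) => (map_zero b).trans ha.symm)
      (LinearMap.fst R B A ∘ₗ (pullback b x).subtype) where
  inj _ _ h := Subtype.ext (congrArg (fun z => z.1.2) h)
  exact := by
    rintro ⟨⟨y, a⟩, h⟩
    constructor
    · rintro (rfl : y = 0)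
      exact ⟨⟨a, h.symm.trans (map_zero b)⟩, rfl⟩
    · rintro ⟨z, hz⟩
      exact (congrArg (fun z => z.1.1) hz).symm
  surj y := by
    obtain ⟨a, ha⟩ := hx (b y)
    exact ⟨⟨(y, a), ha.symm⟩, rfl⟩

lemma isSES_pullback_snd {b : B →ₗ[R] D} (x : A →ₗ[R] D) (hb : Function.Surjective b) :
    IsSES ((LinearMap.inl R B A).restrict (p := LinearMap.ker b) (q := pullback b x)
      fun a (ha : b a = 0) => ha.trans (map_zero x).symm)
      (LinearMap.snd R B A ∘ₗ (pullback b x).subtype) where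
  inj _ _ h := Subtype.ext (congrArg (fun z => z.1.1) h)
  exact := by
    rintro ⟨⟨y, a⟩, h⟩
    constructor
    · rintro (rfl : a = 0)
      exact ⟨⟨y, h.trans (map_zero x)⟩, rfl⟩
    · rintro ⟨z, hz⟩
      exact (congrArg (fun z => z.1.2) hz).symm
  surj a := by
    obtain ⟨y, hy⟩ := hb (x a)
    exact ⟨⟨(y, a), hy⟩, rfl⟩

/-- A short exact sequence with a projective quotient splits. -/
lemma IsSES.nonempty_equiv_prod {f : A →ₗ[R] B} {g : B →ₗ[R] D} (h : IsSES f g)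
    [Module.Projective R D] : Nonempty ((A × D) ≃ₗ[R] B) := by
  obtain ⟨s, hs⟩ := Module.projective_lifting_property g LinearMap.id h.surj
  have hs' : ∀ d, g (s d) = d := LinearMap.congr_fun hs
  refine ⟨LinearEquiv.ofBijective (f.coprod s) ⟨?_, fun b => ?_⟩⟩
  · refine (injective_iff_map_eq_zero _).2 ?_
    rintro ⟨a, d⟩ (e : f a + s d = 0)
    have hd : d = 0 := by
      have := congrArg g e
      rwa [map_add, h.exact.apply_apply_eq_zero, hs', zero_add, map_zero] at this
    subst hd
    rw [map_zero, add_zero] at e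
    rw [h.inj (e.trans (map_zero f).symm)]
    rfl
  · obtain ⟨a, ha⟩ := (h.exact (b - s (g b))).1 (by rw [map_sub, hs', sub_self])
    exact ⟨(a, g b), by simp [ha]⟩

/-! ### Two-out-of-three for finite `C`-Gorenstein dimension -/

variable (C) in
/-- `M` has a finite resolution by totally `C`-reflexive modules. -/
def HasFinDim (M : Type u) [AddCommGroup M] [Module R M] : Prop := ∃ n, FinDim C n M

lemma HasFinDim.congr (e : A ≃ₗ[R] B) (h : HasFinDim C A) : HasFinDim C B :=
  h.imp fun _ h => h.congr e

lemma TotRefl.hasFinDim (h : TotRefl C A) : HasFinDim C A := ⟨0, h⟩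

lemma HasFinDim.finite (h : HasFinDim C A) : Module.Finite R A := h.elim fun _ h => h.finite

lemma HasFinDim.totRefl (h : HasFinDim C A) (hA : ∀ l, 0 < l → ExtVanish (R := R) A C l) :
    TotRefl C A := h.elim fun _ h => h.totRefl hA

section noetherian

variable [IsNoetherianRing R]

/-- For a cover `X → B`, the kernel of `X → D` is totally reflexive and maps onto `ker g` with the
same kernel as `X → B`, so the length does not grow. -/
lemma FinDim.ker_of_totRefl {n : ℕ} (hB : FinDim C n B) (hD : TotRefl C D) {g : B →ₗ[R] D}
    (hg : Function.Surjective g) : FinDim C n (LinearMap.ker g) := by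
  cases n with
  | zero => exact (isSES_ker hg).totRefl_left hB hD
  | succ n =>
    obtain ⟨X, p, hp, hX, hK⟩ := hB
    have := (isSES_ker (g := g ∘ₗ p) (hg.comp hp)).totRefl_left hX hD
    exact (isSES_ker_comp p g hp).finDim_succ hK this

/-- Schanuel's argument: the pullback of `B` and a totally reflexive cover `X` of `D` is `ker p × B`
because `B` is projective, and it also maps onto `X` with kernel `ker g`. -/
lemma FinDim.ker_of_projective {n : ℕ} (hD : FinDim C (n + 1) D) [Module.Projective R B]
    (hB : TotRefl C B) {g : B →ₗ[R] D} (hg : Function.Surjective g) :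
    FinDim C n (LinearMap.ker g) := by
  obtain ⟨X, p, hp, hX, hK⟩ := hD
  obtain ⟨e⟩ := (isSES_pullback_fst g hp).nonempty_equiv_prod
  have h1 := isSES_pullback_snd p hg
  exact (((hK.prod hB).congr e).ker_of_totRefl hX h1.surj).congr h1.kerEquiv.symm

section

variable (hC : IsSemidualizing C)
include hC

/-- The two assertions feed each other: extensions of length `n` give kernels of length `n` by a
pullback, and kernels of length `n` give extensions of length `n + 1` by passing to syzygies. -/
lemma IsSES.finDim_aux (n : ℕ) :
    (∀ {A B D : Type u} [AddCommGroup A] [AddCommGroup B] [AddCommGroup D]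
      [Module R A] [Module R B] [Module R D] {f : A →ₗ[R] B} {g : B →ₗ[R] D}, IsSES f g →
      FinDim C n A → FinDim C n D → FinDim C n B) ∧
    (∀ {A B D : Type u} [AddCommGroup A] [AddCommGroup B] [AddCommGroup D]
      [Module R A] [Module R B] [Module R D] {f : A →ₗ[R] B} {g : B →ₗ[R] D}, IsSES f g →
      FinDim C n B → FinDim C (n + 1) D → FinDim C n A) := by
  have key : ∀ n, (∀ {A B D : Type u} [AddCommGroup A] [AddCommGroup B] [AddCommGroup D]
      [Module R A] [Module R B] [Module R D] {f : A →ₗ[R] B} {g : B →ₗ[R] D}, IsSES f g →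
      FinDim C n A → FinDim C n D → FinDim C n B) →
      (∀ {A B D : Type u} [AddCommGroup A] [AddCommGroup B] [AddCommGroup D]
      [Module R A] [Module R B] [Module R D] {f : A →ₗ[R] B} {g : B →ₗ[R] D}, IsSES f g →
      FinDim C n B → FinDim C (n + 1) D → FinDim C n A) := by
    intro n mid A B D _ _ _ _ _ _ f g h hB hD
    obtain ⟨X, p, hp, hX, hK⟩ := hD
    -- The pullback is an extension of `B` by `ker p`, and the kernel of its projection onto the
    -- totally reflexive `X` is `A`.
    have hW := mid (isSES_pullback_fst g hp) hK hB
    have h1 := isSES_pullback_snd p h.surj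
    exact (hW.ker_of_totRefl hX h1.surj).congr (h1.kerEquiv.symm.trans h.kerEquiv.symm)
  induction n with
  | zero => exact ⟨IsSES.totRefl_mid, key 0 IsSES.totRefl_mid⟩
  | succ n ih =>
    suffices h : _ from ⟨h, key (n + 1) h⟩
    intro A B D _ _ _ _ _ _ f g h hA hD
    have := hA.finite
    have := hD.finite
    have := h.finite_mid
    obtain ⟨m, q, hq⟩ := Module.Finite.exists_fin' R B
    -- This syzygy of `D` has length `n` and maps onto `ker g ≅ A` with kernel `ker q`, so the
    -- second assertion bounds `ker q`.
    have h1 := FinDim.ker_of_projective hD (hC.totRefl_pi m) (g := g ∘ₗ q) (h.surj.comp hq)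
    have h2 := ih.2 (isSES_ker_comp q g hq) h1 (hA.congr h.kerEquiv)
    exact (isSES_ker hq).finDim_succ h2 (hC.totRefl_pi m)

end

variable {f : A →ₗ[R] B} {g : B →ₗ[R] D}

lemma IsSES.finDim_right {n : ℕ} (hC : IsSemidualizing C) (h : IsSES f g) (hA : FinDim C n A)
    (hB : FinDim C (n + 1) B) : FinDim C (n + 1) D := by
  obtain ⟨X, p, hp, hX, hK⟩ := hB
  have h1 := (IsSES.finDim_aux hC n).1 (isSES_ker_comp p g hp) hK (hA.congr h.kerEquiv)
  exact (isSES_ker (g := g ∘ₗ p) (h.surj.comp hp)).finDim_succ h1 hX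

lemma IsSES.hasFinDim_right (hC : IsSemidualizing C) (h : IsSES f g) (hA : HasFinDim C A)
    (hB : HasFinDim C B) : HasFinDim C D := by
  obtain ⟨n, hA⟩ := hA
  obtain ⟨m, hB⟩ := hB
  exact ⟨max n m + 1, h.finDim_right hC (hA.mono (le_max_left n m))
    (hB.mono ((le_max_right n m).trans (Nat.le_succ _)))⟩

lemma IsSES.hasFinDim_left (hC : IsSemidualizing C) (h : IsSES f g) (hB : HasFinDim C B)
    (hD : HasFinDim C D) : HasFinDim C A := by
  obtain ⟨n, hB⟩ := hB
  obtain ⟨m, hD⟩ := hD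
  exact ⟨max n m, (IsSES.finDim_aux hC _).2 h (hB.mono (le_max_left n m))
    (hD.mono ((le_max_right n m).trans (Nat.le_succ _)))⟩

lemma IsSES.hasFinDim_mid (hC : IsSemidualizing C) (h : IsSES f g) (hA : HasFinDim C A)
    (hD : HasFinDim C D) : HasFinDim C B := by
  obtain ⟨n, hA⟩ := hA
  obtain ⟨m, hD⟩ := hD
  exact ⟨max n m, (IsSES.finDim_aux hC _).1 h (hA.mono (le_max_left n m))
    (hD.mono (le_max_right n m))⟩

end noetherian

end GCDim

namespace GCDim

variable {R : Type u} [CommRing R]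

/-! ### Grade and regular elements -/

open Pointwise in
lemma isSES_smul {N : Type*} [AddCommGroup N] [Module R N] {r : R} (hr : IsSMulRegular N r) :
    IsSES (LinearMap.lsmul R N r) (r • ⊤ : Submodule R N).mkQ where
  inj := hr
  exact x := by
    rw [Submodule.mkQ_apply, Submodule.Quotient.mk_eq_zero, Submodule.mem_smul_pointwise_iff_exists]
    simp
  surj := Submodule.mkQ_surjective _

lemma ext_comp_lsmul_eq_zero {E N : Type u} [AddCommGroup E] [Module R E] [AddCommGroup N]
    [Module R N] {r : R} (hr : r ∈ Module.annihilator R E) {n : ℕ}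
    (x : Abelian.Ext (ModuleCat.of R E) (ModuleCat.of R N) n) :
    x.comp (Abelian.Ext.mk₀ (ModuleCat.ofHom (LinearMap.lsmul R N r))) (add_zero n) = 0 := by
  have h1 : ModuleCat.ofHom (LinearMap.lsmul R N r) = r • 𝟙 (ModuleCat.of R N) := by
    ext; rfl
  have h2 : r • 𝟙 (ModuleCat.of R E) = 0 := by
    ext y
    exact Module.mem_annihilator.1 hr y
  rw [h1, ← Abelian.Ext.smul_eq_comp_mk₀, ← Abelian.Ext.mk₀_id_comp x, ← Abelian.Ext.smul_comp,
    ← Abelian.Ext.mk₀_smul, h2, Abelian.Ext.mk₀_zero, Abelian.Ext.zero_comp]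

section

variable {E N : Type u} [AddCommGroup E] [Module R E] [AddCommGroup N] [Module R N]

/-- Multiplication by `r` is zero on `Ext(E, N)`, so the long exact sequence makes `Ext^{l+1}(E, N)`
a quotient of `Ext^l(E, N/rN)`: one degree of vanishing is gained. -/
lemma extVanish_of_isSMulRegular {r : R} (hr : IsSMulRegular N r)
    (hE : r ∈ Module.annihilator R E) {n : ℕ}
    (h : ∀ l < n, ExtVanish (R := R) E (ModuleCat.of R (QuotSMulTop r N)) l) :
    ∀ l < n + 1, ExtVanish (R := R) E (ModuleCat.of R N) l := by
  intro l hl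
  refine subsingleton_of_forall_eq 0 fun x => ?_
  have hx := ext_comp_lsmul_eq_zero hE x
  cases l with
  | zero =>
    refine (extVanish_zero_iff.2 ?_).elim _ _
    refine subsingleton_of_forall_eq 0 fun φ => LinearMap.ext fun e => hr ?_
    change r • φ e = r • (0 : N)
    rw [← map_smul, Module.mem_annihilator.1 hE, map_zero, smul_zero]
  | succ l =>
    obtain ⟨y, rfl⟩ := Abelian.Ext.covariant_sequence_exact₁ _ (isSES_smul hr).shortExact x hx rfl
    rw [(h l (by omega)).elim y 0, Abelian.Ext.zero_comp]

lemma extVanish_quotSMulTop {r : R} (hr : IsSMulRegular N r) {n : ℕ}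
    (h₀ : ExtVanish (R := R) E (ModuleCat.of R N) n)
    (h₁ : ExtVanish (R := R) E (ModuleCat.of R N) (n + 1)) :
    ExtVanish (R := R) E (ModuleCat.of R (QuotSMulTop r N)) n :=
  (isSES_smul hr).ext_cov_right h₀ h₁

/-- If `Ext^l(X, N) = 0` for `l < n` and `E` is annihilated by the annihilator of `X`, then
`Ext^l(E, N) = 0` for `l < n`. -/
lemma extVanish_of_annihilator_le [IsNoetherianRing R] {X : Type u} [AddCommGroup X] [Module R X]
    [Module.Finite R X] (hE : Module.annihilator R X ≤ Module.annihilator R E) (n : ℕ)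
    (N : Type u) [AddCommGroup N] [Module R N] [Module.Finite R N]
    (h : ∀ l < n, ExtVanish (R := R) X (ModuleCat.of R N) l) :
    ∀ l < n, ExtVanish (R := R) E (ModuleCat.of R N) l := by
  induction n generalizing N with
  | zero => intro l hl; omega
  | succ n ih =>
    have h0 := extVanish_zero_iff.1 (h 0 n.succ_pos)
    -- `Hom(X, N) = 0` produces an `N`-regular element in the annihilator of `X`, which then kills
    -- `E` as well.
    obtain ⟨r, hr, hN⟩ := IsSMulRegular.subsingleton_linearMap_iff.1 h0
    refine extVanish_of_isSMulRegular hN (hE hr) (ih (QuotSMulTop r N) fun l hl => ?_)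
    exact extVanish_quotSMulTop hN (h l (by omega)) (h (l + 1) (by omega))

end

/-! ### Dividing `R` and `C` by a common regular sequence -/

/-- `N ≅ Hom(C, N')` and `Ext^i(C, N') = 0` for `i > 0`. -/
structure IsDualPair (C : ModuleCat.{u} R) (N N' : Type u) [AddCommGroup N] [Module R N]
    [AddCommGroup N'] [Module R N'] : Prop where
  nonempty_equiv : Nonempty (N ≃ₗ[R] (C →ₗ[R] N'))
  ext_eq_zero : ∀ i : ℕ, 0 < i → Subsingleton (Abelian.Ext C (ModuleCat.of R N') i)

variable {C : ModuleCat.{u} R}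

lemma IsSemidualizing.isDualPair (hC : IsSemidualizing C) : IsDualPair C R C where
  nonempty_equiv := ⟨LinearEquiv.ofBijective _ hC.homothety_bijective⟩
  ext_eq_zero := hC.ext_eq_zero

section

variable {N N' : Type u} [AddCommGroup N] [Module R N] [AddCommGroup N'] [Module R N']

/-- A map from `C` to the `r`-torsion `U` of `N'` is an element of `N` killed by `r`, so `Hom(C, U)
= 0`. Since `C` is faithful, this forces `U = 0`. -/
lemma IsDualPair.isSMulRegular [IsNoetherianRing R] (hC : IsSemidualizing C)
    (h : IsDualPair C N N') [Module.Finite R N'] {r : R} (hr : IsSMulRegular N r) :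
    IsSMulRegular N' r := by
  obtain ⟨e⟩ := h.nonempty_equiv
  have := hC.finite
  let U := LinearMap.ker (LinearMap.lsmul R N' r)
  have hU : Subsingleton (C →ₗ[R] U) := by
    refine subsingleton_of_forall_eq 0 fun φ => ?_
    have h1 : r • (U.subtype ∘ₗ φ) = 0 := LinearMap.ext fun c => (φ c).2
    have h2 : r • e.symm (U.subtype ∘ₗ φ) = r • 0 := by rw [← map_smul, h1, map_zero, smul_zero]
    have h3 := (LinearEquiv.map_eq_zero_iff _).1 (hr h2)
    exact LinearMap.ext fun c => Subtype.ext (LinearMap.congr_fun h3 c)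
  obtain ⟨s, hs, hs'⟩ := IsSMulRegular.subsingleton_linearMap_iff.1 hU
  -- `C` is faithful, so the `U`-regular element annihilating it is zero.
  have : s = 0 := hC.homothety_bijective.1 ((LinearMap.ext (Module.mem_annihilator.1 hs)).trans
    (map_zero _).symm)
  subst this
  have hU0 : Subsingleton U := IsSMulRegular.zero_iff_subsingleton.1 hs'
  intro x y hxy
  have : x - y ∈ U := by
    change r • (x - y) = 0
    rw [smul_sub]
    exact sub_eq_zero.2 hxy
  exact sub_eq_zero.1 (congrArg Subtype.val (Subsingleton.elim (⟨x - y, this⟩ : U) 0))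

open Pointwise in
lemma IsDualPair.quotSMulTop (h : IsDualPair C N N') {r : R} (hr : IsSMulRegular N' r) :
    IsDualPair C (QuotSMulTop r N) (QuotSMulTop r N') where
  ext_eq_zero i hi := (isSES_smul hr).ext_cov_right (h.ext_eq_zero i hi)
    (h.ext_eq_zero (i + 1) i.succ_pos)
  nonempty_equiv := by
    obtain ⟨e⟩ := h.nonempty_equiv
    have hS := isSES_smul hr
    let q : N →ₗ[R] (C →ₗ[R] QuotSMulTop r N') :=
      LinearMap.compRight R (r • ⊤ : Submodule R N').mkQ ∘ₗ e.toLinearMap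
    have hq : Function.Surjective q := by
      intro φ
      obtain ⟨y, hy⟩ := Abelian.Ext.covariant_sequence_exact₃ C hS.shortExact
        (Abelian.Ext.mk₀ (ModuleCat.ofHom φ)) (zero_add 1)
        ((h.ext_eq_zero 1 one_pos).elim _ _)
      obtain ⟨z, rfl⟩ := (Abelian.Ext.mk₀_bijective _ _).2 y
      rw [Abelian.Ext.mk₀_comp_mk₀] at hy
      refine ⟨e.symm z.hom, ?_⟩
      have := congrArg ModuleCat.Hom.hom ((Abelian.Ext.mk₀_bijective _ _).1 hy)
      simpa [q] using! this
    have hker : LinearMap.ker q = r • ⊤ := by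
      ext x
      rw [Submodule.mem_smul_pointwise_iff_exists]
      constructor
      · intro hx
        have hx' : ∀ c, (r • ⊤ : Submodule R N').mkQ (e x c) = 0 := LinearMap.congr_fun hx
        -- The map `e x` has values in `r N'`, and `r` is regular on `N'`, so `e x` can be divided
        -- by `r`.
        have : LinearMap.range (e x) ≤ LinearMap.range (LinearMap.lsmul R N' r) := by
          rintro _ ⟨c, rfl⟩
          exact (hS.exact _).1 (hx' c)
        let ψ : C →ₗ[R] N' := (LinearEquiv.ofInjective _ hS.inj).symm.toLinearMap ∘ₗ
          (e x).codRestrict (LinearMap.range (LinearMap.lsmul R N' r)) fun c => this ⟨c, rfl⟩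
        have hψ : r • ψ = e x := LinearMap.ext fun c =>
          congrArg Subtype.val ((LinearEquiv.ofInjective _ hS.inj).apply_symm_apply
            ⟨e x c, this ⟨c, rfl⟩⟩)
        exact ⟨e.symm ψ, trivial, by rw [← map_smul, hψ, e.symm_apply_apply]⟩
      · rintro ⟨y, -, rfl⟩
        refine LinearMap.ext fun c => ?_
        change (r • ⊤ : Submodule R N').mkQ (e (r • y) c) = 0
        rw [map_smul]
        exact hS.exact.apply_apply_eq_zero (e y c)
    exact ⟨(Submodule.quotEquivOfEq _ _ hker.symm).trans (q.quotKerEquivOfSurjective hq)⟩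

end

-- Divide `N` and `N'` by a regular element of the annihilator of `M`, `n` times. The pair is kept
-- general because the induction replaces it by its quotient. Each division preserves finite
-- dimension, raises the bound for nonvanishing `Ext(-, C)` by at most one, and shifts `Ext(E, -)`
-- by one degree.
open Pointwise in
lemma exists_quotient_of_extVanish [IsNoetherianRing R] (hC : IsSemidualizing C)
    {M : Type u} [AddCommGroup M] [Module R M] [Module.Finite R M] (n : ℕ)
    (N N' : Type u) [AddCommGroup N] [Module R N] [AddCommGroup N'] [Module R N']
    [Module.Finite R N] [Module.Finite R N'] (hN : IsDualPair C N N')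
    (h : ∀ l < n, ExtVanish (R := R) M (ModuleCat.of R N) l) :
    ∃ (J : Ideal R) (T : ModuleCat.{u} R) (π : N →ₗ[R] T), J ≤ Module.annihilator R M ∧
      Function.Surjective π ∧ LinearMap.ker π = J • ⊤ ∧
      (HasFinDim C N → HasFinDim C T) ∧
      (∀ b, (∀ l, b < l → ExtVanish (R := R) N C l) → ∀ l, b + n < l →
        ExtVanish (R := R) T C l) ∧
      (∀ (E : Type u) [AddCommGroup E] [Module R E], J ≤ Module.annihilator R E →
        (∀ l < n, ExtVanish (R := R) E (ModuleCat.of R N) l) ∧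
        (∀ l < n, ExtVanish (R := R) E (ModuleCat.of R N') l) ∧
        (Nontrivial (E →ₗ[R] T) →
          Nontrivial (Abelian.Ext (ModuleCat.of R E) (ModuleCat.of R N) n))) := by
  induction n generalizing N N' with
  | zero =>
    refine ⟨⊥, ModuleCat.of R N, LinearMap.id, bot_le, Function.surjective_id, by simp, id,
      fun b h => h, fun E _ _ _ => ⟨by simp, by simp, fun h => ?_⟩⟩
    exact (Abelian.Ext.addEquiv₀.trans ModuleCat.homAddEquiv).toEquiv.nontrivial
  | succ n ih =>
    have h0 := extVanish_zero_iff.1 (h 0 n.succ_pos)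
    obtain ⟨r, hr, hrN⟩ := IsSMulRegular.subsingleton_linearMap_iff.1 h0
    have hrN' := hN.isSMulRegular hC hrN
    obtain ⟨J, T, π, hJ, hπ, hker, hfin, hext, hE⟩ := ih (QuotSMulTop r N) (QuotSMulTop r N')
      (hN.quotSMulTop hrN') fun l hl =>
        extVanish_quotSMulTop hrN (h l (by omega)) (h (l + 1) (by omega))
    have hS := isSES_smul hrN
    refine ⟨Ideal.span {r} ⊔ J, T, π ∘ₗ (r • ⊤ : Submodule R N).mkQ, ?_,
      hπ.comp (Submodule.mkQ_surjective _), ?_, ?_, ?_, ?_⟩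
    · exact sup_le ((Ideal.span_singleton_le_iff_mem _).2 hr) hJ
    · rw [LinearMap.ker_comp, hker, Submodule.sup_smul, Submodule.ideal_span_singleton_smul,
        ← Submodule.range_mkQ (r • ⊤ : Submodule R N), ← Submodule.map_top,
        ← Submodule.map_smul'', Submodule.comap_map_mkQ]
    · exact fun hf => hfin (hS.hasFinDim_right hC hf hf)
    · intro b hb l hl
      refine hext (b + 1) (fun l hl => ?_) l (by omega)
      obtain ⟨l, rfl⟩ := Nat.exists_eq_succ_of_ne_zero (by omega : l ≠ 0)
      exact hS.ext_right (hb l (by omega)) (hb (l + 1) (by omega))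
    · intro E _ _ hJE
      have hrE : r ∈ Module.annihilator R E :=
        hJE (le_sup_left (a := Ideal.span {r}) (Ideal.mem_span_singleton_self r))
      obtain ⟨h1, h2, h3⟩ := hE E (le_sup_right.trans hJE)
      have h1' := extVanish_of_isSMulRegular hrN hrE h1
      refine ⟨h1', extVanish_of_isSMulRegular hrN' hrE h2, fun h => ?_⟩
      have := h3 h
      -- If `Ext^{n+1}(E, N)` vanished along with `Ext^n(E, N)`, so would `Ext^n(E, N/rN)`, which is
      -- nonzero by induction.
      by_contra hcon
      rw [not_nontrivial_iff_subsingleton] at hcon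
      exact not_subsingleton _ (extVanish_quotSMulTop hrN (h1' n n.lt_succ_self) hcon)

/-! ### Quotients by regular sequences -/

/-- A module `T = R/J` which behaves like the quotient of `R` by a regular sequence of length
`n`. -/
structure IsPerfectQuotient (C : ModuleCat.{u} R) (J : Ideal R) (n : ℕ) (T : Type u)
    [AddCommGroup T] [Module R T] : Prop where
  le_annihilator : J ≤ Module.annihilator R T
  hasFinDim : HasFinDim C T
  ext_eq_zero : ∀ l, n < l → ExtVanish (R := R) T C l
  ext_self_eq_zero : ∀ (K : Type u) [AddCommGroup K] [Module R K], J ≤ Module.annihilator R K →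
    ∀ l < n, ExtVanish (R := R) K (ModuleCat.of R R) l
  ext_dualizing_eq_zero : ∀ (K : Type u) [AddCommGroup K] [Module R K],
    J ≤ Module.annihilator R K → ∀ l < n, ExtVanish (R := R) K C l
  nontrivial_ext : ∀ (K : Type u) [AddCommGroup K] [Module R K], J ≤ Module.annihilator R K →
    Nontrivial (K →ₗ[R] T) → Nontrivial (Abelian.Ext (ModuleCat.of R K) (ModuleCat.of R R) n)
  exists_surjective : ∀ (K : Type u) [AddCommGroup K] [Module R K] [Module.Finite R K],
    J ≤ Module.annihilator R K → ∃ (m : ℕ) (f : (Fin m → T) →ₗ[R] K), Function.Surjective f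

theorem exists_isPerfectQuotient [IsNoetherianRing R] (hC : IsSemidualizing C)
    (M : Type u) [AddCommGroup M] [Module R M] [Module.Finite R M] (n : ℕ)
    (h : ∀ l < n, ExtVanish (R := R) M (ModuleCat.of R R) l) :
    ∃ (J : Ideal R) (T : ModuleCat.{u} R), J ≤ Module.annihilator R M ∧
      IsPerfectQuotient C J n T := by
  have := hC.finite
  obtain ⟨J, T, π, hJ, hπ, hker, hfin, hext, hE⟩ :=
    exists_quotient_of_extVanish hC n R C hC.isDualPair h
  refine ⟨J, T, hJ, ?_, hfin hC.totRefl_self.hasFinDim, fun l hl => hext 0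
    (fun l hl => extVanish_of_projective hl) l (by omega), fun K _ _ hK => (hE K hK).1,
    fun K _ _ hK => (hE K hK).2.1, fun K _ _ hK => (hE K hK).2.2, fun K _ _ _ hK => ?_⟩
  · intro a ha
    rw [Module.mem_annihilator]
    intro t
    obtain ⟨x, rfl⟩ := hπ t
    rw [← map_smul]
    exact hker.ge (Submodule.smul_mem_smul ha trivial)
  · obtain ⟨m, f, hf⟩ := Module.Finite.exists_fin' R K
    -- The kernel of `π` is `J`, which kills `K`, so the free cover of `K` factors through a power
    -- of `T`.
    have key : ∀ φ : R →ₗ[R] K, ∃ ψ : T →ₗ[R] K, ψ ∘ₗ π = φ := fun φ =>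
      (isSES_ker hπ).exists_desc φ (LinearMap.ext fun ⟨x, hx⟩ => by
        rw [hker] at hx
        change φ x = 0
        have hx : x ∈ J := by simpa using hx
        rw [← mul_one x, ← smul_eq_mul, map_smul]
        exact Module.mem_annihilator.1 (hK hx) _)
    choose ψ hψ using fun j => key (f ∘ₗ LinearMap.single R (fun _ : Fin m => R) j)
    refine ⟨m, LinearMap.lsum R (fun _ => T) R ψ, fun y => ?_⟩
    obtain ⟨x, rfl⟩ := hf y
    refine ⟨fun j => π (x j), ?_⟩
    have h1 : ∀ j, ψ j (π (x j)) = f (Pi.single j (x j)) := fun j => LinearMap.congr_fun (hψ j) _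
    rw [LinearMap.lsum_apply, LinearMap.sum_apply]
    simp only [LinearMap.comp_apply, LinearMap.proj_apply, h1]
    rw [← map_sum, Finset.univ_sum_single]

end GCDim

namespace GCDim

variable {R : Type u} [CommRing R]

/-! ### Resolutions by finitely generated free modules -/

section

/-- A surjection from a finitely generated free module onto a finitely generated module. -/
noncomputable def freeCover (M : {X : ModuleCat.{u} R // Module.Finite R X}) :
    Σ m : ℕ, (Fin m → R) →ₗ[R] M.1 :=
  have := M.2
  ⟨(Module.Finite.exists_fin' R M.1).choose, (Module.Finite.exists_fin' R M.1).choose_spec.choose⟩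

lemma freeCover_surjective (M : {X : ModuleCat.{u} R // Module.Finite R X}) :
    Function.Surjective (freeCover M).2 :=
  have := M.2
  (Module.Finite.exists_fin' R M.1).choose_spec.choose_spec

variable [IsNoetherianRing R]

/-- The syzygies of a finitely generated module in a free resolution. -/
noncomputable def freeSyzygy (M : {X : ModuleCat.{u} R // Module.Finite R X}) :
    ℕ → {X : ModuleCat.{u} R // Module.Finite R X}
  | 0 => M
  | k + 1 => ⟨ModuleCat.of R (LinearMap.ker (freeCover (freeSyzygy M k)).2),
      inferInstanceAs (Module.Finite R (LinearMap.ker (freeCover (freeSyzygy M k)).2))⟩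

variable (M : {X : ModuleCat.{u} R // Module.Finite R X})

/-- The differential of the free resolution. -/
noncomputable def freeD (k : ℕ) :
    (Fin (freeCover (freeSyzygy M (k + 1))).1 → R) →ₗ[R]
      (Fin (freeCover (freeSyzygy M k)).1 → R) :=
  (LinearMap.ker (freeCover (freeSyzygy M k)).2).subtype ∘ₗ (freeCover (freeSyzygy M (k + 1))).2

lemma freeD_exact_cover (k : ℕ) : Function.Exact (freeD M k) (freeCover (freeSyzygy M k)).2 := by
  intro x
  constructor
  · intro hx
    obtain ⟨y, hy⟩ := freeCover_surjective (freeSyzygy M (k + 1)) ⟨x, hx⟩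
    exact ⟨y, congrArg Subtype.val hy⟩
  · rintro ⟨y, rfl⟩
    exact ((freeCover (freeSyzygy M (k + 1))).2 y).2

lemma freeD_exact (k : ℕ) : Function.Exact (freeD M (k + 1)) (freeD M k) := by
  intro x
  rw [← freeD_exact_cover M (k + 1) x]
  exact ⟨fun h => Subtype.ext h, fun h => congrArg Subtype.val h⟩

/-- The free resolution, as a chain complex. -/
noncomputable def freeComplex : ChainComplex (ModuleCat.{u} R) ℕ :=
  ChainComplex.of (fun k => ModuleCat.of R (Fin (freeCover (freeSyzygy M k)).1 → R))
    (fun k => ModuleCat.ofHom (freeD M k))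
    fun k => ModuleCat.hom_ext (LinearMap.ext (freeD_exact M k).apply_apply_eq_zero)

lemma freeComplex_d (k : ℕ) :
    (freeComplex M).d (k + 1) k = ModuleCat.ofHom (freeD M k) :=
  ChainComplex.of_d (fun k => ModuleCat.of R (Fin (freeCover (freeSyzygy M k)).1 → R))
    (fun k => ModuleCat.ofHom (freeD M k)) k

/-- The augmentation of the free resolution. -/
noncomputable def freeAugmentation : (freeComplex M).X 0 ⟶ M.1 :=
  ModuleCat.ofHom (freeCover M).2

lemma freeComplex_d_comp_augmentation : (freeComplex M).d 1 0 ≫ freeAugmentation M = 0 := by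
  rw [freeComplex_d]
  exact ModuleCat.hom_ext (LinearMap.ext (freeD_exact_cover M 0).apply_apply_eq_zero)

lemma freeComplex_exactAt (k : ℕ) : (freeComplex M).ExactAt (k + 1) := by
  rw [HomologicalComplex.exactAt_iff' _ (k + 1 + 1) (k + 1) k (by simp) (by simp)]
  refine (ShortComplex.ShortExact.moduleCat_exact_iff_function_exact _).2 ?_
  change Function.Exact ((freeComplex M).d (k + 2) (k + 1)) ((freeComplex M).d (k + 1) k)
  rw [freeComplex_d, freeComplex_d]
  exact freeD_exact M k

/-- The free resolution, as a projective resolution. -/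
noncomputable def freeResolution : ProjectiveResolution M.1 where
  complex := freeComplex M
  projective k := (IsProjective.iff_projective (R := R)
    (Fin (freeCover (freeSyzygy M k)).1 → R)).1 inferInstance
  π := (ChainComplex.toSingle₀Equiv _ _).symm
    ⟨freeAugmentation M, freeComplex_d_comp_augmentation M⟩
  quasiIso := ⟨fun n => by
    cases n
    · rw [ChainComplex.quasiIsoAt₀_iff, ShortComplex.quasiIso_iff_of_zeros']
      · refine (ShortComplex.exact_and_epi_g_iff_of_iso
          (S₂ := ShortComplex.mk _ _ (freeComplex_d_comp_augmentation M)) ?_).2 ⟨?_, ?_⟩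
        · exact ShortComplex.isoMk (Iso.refl _) (Iso.refl _) (Iso.refl _)
            ((Category.id_comp _).trans (Category.comp_id _).symm)
            ((Category.id_comp _).trans (Category.comp_id _).symm)
        · refine (ShortComplex.ShortExact.moduleCat_exact_iff_function_exact _).2 ?_
          change Function.Exact ((freeComplex M).d 1 0) (freeAugmentation M)
          rw [freeComplex_d]
          exact freeD_exact_cover M 0
        · exact (ModuleCat.epi_iff_surjective _).2 (freeCover_surjective M)
      all_goals rfl
    · rw [quasiIsoAt_iff_exactAt']
      · apply freeComplex_exactAt
      · apply ChainComplex.exactAt_succ_single_obj⟩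

/-- The resolution in the definition of `delta` need not have finitely generated terms; biduality
needs terms that are totally reflexive, hence finite. -/
theorem exists_freeResolution (M : ModuleCat.{u} R) [Module.Finite R M] :
    ∃ P : ProjectiveResolution M, ∀ k, ∃ m : ℕ, Nonempty ((Fin m → R) ≃ₗ[R] P.complex.X k) :=
  ⟨freeResolution ⟨M, inferInstance⟩, fun _ => ⟨_, ⟨LinearEquiv.refl R _⟩⟩⟩

end

end GCDim

namespace GCDim

variable {R : Type u} [CommRing R]

/-! ### The dual of a resolution by totally reflexive modules -/

lemma isSES_range {A B D : Type*} [AddCommGroup A] [AddCommGroup B] [AddCommGroup D]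
    [Module R A] [Module R B] [Module R D] {f : A →ₗ[R] B} {g : B →ₗ[R] D}
    (h : Function.Exact f g) : IsSES (LinearMap.range f).subtype g.rangeRestrict where
  inj := Subtype.val_injective
  exact x := (Subtype.ext_iff.trans (h x)).trans (by simp)
  surj := g.surjective_rangeRestrict

section

variable {M : ModuleCat.{u} R} (P : ProjectiveResolution M) (C : ModuleCat.{u} R)

lemma isSES_ext (n : ℕ) : IsSES (boundaryToCocycle P C n) (cocycleToExt P C (n + 1)) :=
  ⟨fun _ _ h => Subtype.ext (congrArg (fun z : LinearMap.ker (dualD P C (n + 1)) => z.1) h),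
    cocycleToExt_eq_zero_iff P C n, cocycleToExt_surjective P C (n + 1)⟩

lemma isSES_augmentation :
    IsSES (LinearMap.range (P.complex.d 1 0).hom).subtype (augmentation P) where
  inj := Subtype.val_injective
  exact x := (augmentation_exact P x).trans (by simp)
  surj := augmentation_surjective P

lemma isSES_syzygy (k : ℕ) : IsSES (LinearMap.range (P.complex.d (k + 2) (k + 1)).hom).subtype
    (P.complex.d (k + 1) k).hom.rangeRestrict :=
  isSES_range ((ShortComplex.ShortExact.moduleCat_exact_iff_function_exact _).1 (P.exact_succ k))

variable {P C}

lemma evalAt_d (k : ℕ) (q : P.complex.X (k + 1)) (f : P.complex.X k ⟶ C) :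
    evalAt P C k ((P.complex.d (k + 1) k).hom q) f = evalAt P C (k + 1) q (dualD P C k f) := rfl

lemma evalRange_dualD (h₀ : Subsingleton (Abelian.Ext M C 0)) (p : P.complex.X 0)
    (f : P.complex.X 0 ⟶ C) :
    evalRange P C h₀ p ⟨dualD P C 0 f, f, rfl⟩ = evalAt P C 0 p f :=
  congrArg (evalAt P C 0 p) ((LinearEquiv.ofInjective _ (dualD_zero_injective P C h₀)).symm_apply_apply f)

variable (P C) in
/-- The pushforward along the evaluation at `p ∈ P_0` of the Yoneda class of
`0 → im d^0 → Hom(P_1, C) → ⋯ → Hom(P_n, C) → im d^n → 0`. -/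
noncomputable def yonedaEval (n : ℕ) (h : ∀ i < n + 1, Subsingleton (Abelian.Ext M C i))
    (p : P.complex.X 0) :
    Abelian.Ext (ModuleCat.of R (LinearMap.range (dualD P C n))) C n :=
  (yonedaClass P C n fun i hi => h (i + 1) (Nat.succ_lt_succ hi)).comp
    (Abelian.Ext.mk₀ (ModuleCat.ofHom (evalRange P C (h 0 n.succ_pos) p))) (Nat.add_zero n)

lemma yonedaEval_succ (n : ℕ) (h : ∀ i < n + 2, Subsingleton (Abelian.Ext M C i))
    (p : P.complex.X 0) :
    yonedaEval P C (n + 1) h p =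
      (isSES_range (dualD_exact P C n (h (n + 1) (by omega)))).shortExact.extClass.comp
        (yonedaEval P C n (fun i hi => h i (by omega)) p) (add_comm 1 n) := by
  rw [yonedaEval, yonedaClass, Abelian.Ext.comp_assoc_of_third_deg_zero]
  rfl

lemma yonedaEval_d {n : ℕ} (hn : 0 < n) (h : ∀ i < n + 1, Subsingleton (Abelian.Ext M C i))
    (q : P.complex.X 1) : yonedaEval P C n h ((P.complex.d 1 0).hom q) = 0 := by
  obtain ⟨n, rfl⟩ := Nat.exists_eq_succ_of_ne_zero hn.ne'
  rw [yonedaEval, evalRange_d]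
  exact yonedaClass_comp_eval P C n _ q

variable (hP : ∀ k, TotRefl C (P.complex.X k))
include hP

lemma evalAt_bijective (k : ℕ) : Function.Bijective (evalAt P C k) := by
  have : ⇑(evalAt P C k) = (ModuleCat.homLinearEquiv (S := R)).symm.congrLeft C R ∘
    bidualMap C (P.complex.X k) := rfl
  rw [this]
  exact (LinearEquiv.bijective _).comp (hP k).bijective

lemma extVanish_dual (k : ℕ) {l : ℕ} (hl : 0 < l) :
    ExtVanish (R := R) (P.complex.X k ⟶ C) C l :=
  ((hP k).dual_ext_eq_zero l hl).congr (ModuleCat.homLinearEquiv (S := R)).symm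

/-- Pulled back to `Hom(P_{k+1}, C)`, the functional is evaluation at some `p`. It kills
coboundaries, so `d p = 0`, and exactness of `P` gives `p = d q`. -/
lemma exists_evalAt_eq (k : ℕ) (φ : LinearMap.range (dualD P C (k + 1)) →ₗ[R] C) :
    ∃ q : P.complex.X (k + 2),
      φ = evalAt P C (k + 2) q ∘ₗ (LinearMap.range (dualD P C (k + 1))).subtype := by
  obtain ⟨p, hp⟩ := (evalAt_bijective hP (k + 1)).2 (φ ∘ₗ (dualD P C (k + 1)).rangeRestrict)
  have hd : (P.complex.d (k + 1) k).hom p = 0 := by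
    refine (evalAt_bijective hP k).1 (LinearMap.ext fun f => ?_)
    rw [evalAt_d, hp, map_zero]
    change φ ⟨dualD P C (k + 1) (dualD P C k f), _⟩ = 0
    refine (congrArg φ ?_).trans (map_zero φ)
    exact Subtype.ext (dualD_comp P C k f)
  obtain ⟨q, rfl⟩ := ((ShortComplex.ShortExact.moduleCat_exact_iff_function_exact _).1
    (P.exact_succ k) p).1 hd
  refine ⟨q, LinearMap.ext ?_⟩
  rintro ⟨_, f, rfl⟩
  exact (LinearMap.congr_fun hp f).symm

lemma evalRange_bijective (h₀ : Subsingleton (Abelian.Ext M C 0)) :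
    Function.Bijective (evalRange P C h₀) := by
  constructor
  · intro p q hpq
    refine (evalAt_bijective hP 0).1 (LinearMap.ext fun f => ?_)
    rw [← evalRange_dualD h₀, hpq, evalRange_dualD]
  · intro φ
    obtain ⟨p, hp⟩ := (evalAt_bijective hP 0).2 (φ ∘ₗ (dualD P C 0).rangeRestrict)
    refine ⟨p, LinearMap.ext ?_⟩
    rintro ⟨_, f, rfl⟩
    rw [evalRange_dualD, hp]
    rfl

/-- Dimension shifting from `im d^0 ≅ Hom(P_0, C)`. Degree `l = k` is excluded: there the cokernel
of `P_1 → P_0`, that is `M`, appears. -/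
lemma extVanish_range_dualD (k : ℕ) (h : ∀ i < k + 1, Subsingleton (Abelian.Ext M C i)) {l : ℕ}
    (hl : 0 < l) (hlk : l ≠ k) : ExtVanish (R := R) (LinearMap.range (dualD P C k)) C l := by
  induction k generalizing l with
  | zero =>
    exact (extVanish_dual hP 0 hl).congr
      (LinearEquiv.ofInjective _ (dualD_zero_injective P C (h 0 one_pos)))
  | succ k ih =>
    have hS := isSES_range (dualD_exact P C k (h (k + 1) (by omega)))
    obtain ⟨l, rfl⟩ := Nat.exists_eq_succ_of_ne_zero hl.ne'
    rcases Nat.eq_zero_or_pos l with rfl | hl'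
    -- In degree one the shift ends in `Hom`, where every functional is an evaluation and therefore
    -- extends to the middle term.
    · obtain ⟨k, rfl⟩ := Nat.exists_eq_succ_of_ne_zero (by omega : k ≠ 0)
      refine subsingleton_of_forall_eq 0 fun x => ?_
      obtain ⟨y, rfl⟩ := Abelian.Ext.contravariant_sequence_exact₃ hS.shortExact C x
        ((extVanish_dual hP _ one_pos).elim _ _) (add_zero 1)
      obtain ⟨φ, rfl⟩ := (Abelian.Ext.mk₀_bijective _ _).2 y
      obtain ⟨q, hq⟩ := exists_evalAt_eq hP k φ.hom
      have : φ = hS.sc.f ≫ ModuleCat.ofHom (evalAt P C _ q) := ModuleCat.hom_ext hq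
      rw [this, ← Abelian.Ext.mk₀_comp_mk₀]
      exact hS.shortExact.extClass_comp_assoc _
    · exact hS.ext_right (ih (fun i hi => h i (by omega)) hl' (by omega))
        (extVanish_dual hP _ l.succ_pos)

lemma exists_yonedaEval_eq (n : ℕ) (h : ∀ i < n + 1, Subsingleton (Abelian.Ext M C i))
    (x : Abelian.Ext (ModuleCat.of R (LinearMap.range (dualD P C n))) C n) :
    ∃ p, yonedaEval P C n h p = x := by
  induction n with
  | zero =>
    obtain ⟨φ, rfl⟩ := (Abelian.Ext.mk₀_bijective _ _).2 x
    obtain ⟨p, hp⟩ := (evalRange_bijective hP (h 0 one_pos)).2 φ.hom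
    refine ⟨p, ?_⟩
    change (Abelian.Ext.mk₀ (𝟙 _)).comp _ _ = _
    rw [Abelian.Ext.mk₀_id_comp, hp]
    rfl
  | succ n ih =>
    have hS := isSES_range (dualD_exact P C n (h (n + 1) (by omega)))
    obtain ⟨y, rfl⟩ := Abelian.Ext.contravariant_sequence_exact₃ hS.shortExact C x
      ((extVanish_dual hP _ n.succ_pos).elim _ _) (add_comm 1 n)
    obtain ⟨p, rfl⟩ := ih (fun i hi => h i (by omega)) y
    exact ⟨p, yonedaEval_succ n h p⟩

/-- The kernel of the composition of `yonedaEval` with a connecting map. -/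
lemma mem_range_of_extClass_comp_yonedaEval_eq_zero (n : ℕ)
    (h : ∀ i < n + 1, Subsingleton (Abelian.Ext M C i))
    {Y E : Type u} [AddCommGroup Y] [Module R Y] [AddCommGroup E] [Module R E]
    {f : LinearMap.range (dualD P C n) →ₗ[R] Y} {g : Y →ₗ[R] E} (hS : IsSES f g)
    (hY : 0 < n → ExtVanish (R := R) Y C n)
    (hY' : ∀ ψ : Y →ₗ[R] C, ∃ q, ψ ∘ₗ f =
      evalAt P C (n + 1) q ∘ₗ (LinearMap.range (dualD P C n)).subtype)
    (p : P.complex.X 0)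
    (hp : hS.shortExact.extClass.comp (yonedaEval P C n h p) (add_comm 1 n) = 0) :
    p ∈ LinearMap.range (P.complex.d 1 0).hom := by
  induction n generalizing Y E with
  | zero =>
    -- Evaluation at `p` extends to `Y`, hence agrees on `im d^0` with evaluation at some `q ∈ P_1`,
    -- and so `p = d q`.
    obtain ⟨x, hx⟩ := Abelian.Ext.contravariant_sequence_exact₁ hS.shortExact C _ _ hp
    obtain ⟨ψ, rfl⟩ := (Abelian.Ext.mk₀_bijective _ _).2 x
    obtain ⟨q, hq⟩ := hY' ψ.hom
    rw [Abelian.Ext.mk₀_comp_mk₀] at hx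
    change _ = (Abelian.Ext.mk₀ (𝟙 _)).comp _ _ at hx
    rw [Abelian.Ext.mk₀_id_comp] at hx
    have hx' := congrArg ModuleCat.Hom.hom ((Abelian.Ext.mk₀_bijective _ _).1 hx)
    refine ⟨q, (evalRange_bijective hP (h 0 one_pos)).1 ?_⟩
    rw [evalRange_d, ← hq]
    exact hx'
  | succ n ih =>
    obtain ⟨x, hx⟩ := Abelian.Ext.contravariant_sequence_exact₁ hS.shortExact C _ _ hp
    -- The last connecting map is injective, so the class vanishes one stage earlier; there
    -- `Hom(P_{n+1}, C)` takes the role of `Y`.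
    rw [(hY n.succ_pos).elim x 0, Abelian.Ext.comp_zero, yonedaEval_succ] at hx
    refine ih (fun i hi => h i (by omega)) (isSES_range (dualD_exact P C n (h (n + 1) (by omega))))
      (fun hn => extVanish_dual hP _ hn) (fun ψ => ?_) hx.symm
    obtain ⟨q, rfl⟩ := (evalAt_bijective hP (n + 1)).2 ψ
    exact ⟨q, rfl⟩

end

/-! ### Syzygies and the natural map -/

section

variable {M : ModuleCat.{u} R} (P : ProjectiveResolution M) (C : ModuleCat.{u} R)

/-- The cocycles in `Hom(P_k, C)` are the maps from the image of `P_k` in `P_{k-1}`. -/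
lemma exists_cocycle_equiv (k : ℕ) :
    ∃ e : (LinearMap.range (P.complex.d (k + 1) k).hom →ₗ[R] C) ≃ₗ[R]
      LinearMap.ker (dualD P C (k + 1)),
      ∀ φ q, (e φ).1.hom q = φ ((P.complex.d (k + 1) k).hom.rangeRestrict q) := by
  have hS := isSES_syzygy P k
  let c : (LinearMap.range (P.complex.d (k + 1) k).hom →ₗ[R] C) →ₗ[R]
      LinearMap.ker (dualD P C (k + 1)) :=
    LinearMap.codRestrict _ ((ModuleCat.homLinearEquiv (S := R)).symm.toLinearMap ∘ₗ
      LinearMap.lcomp R C (P.complex.d (k + 1) k).hom.rangeRestrict) fun φ =>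
        ModuleCat.hom_ext (LinearMap.ext fun x => by
          change φ ((P.complex.d (k + 1) k).hom.rangeRestrict
            ((P.complex.d (k + 2) (k + 1)).hom x)) = 0
          exact (congrArg φ (hS.exact.apply_apply_eq_zero ⟨_, x, rfl⟩)).trans (map_zero φ))
  refine ⟨LinearEquiv.ofBijective c ⟨?_, ?_⟩, fun φ q => rfl⟩
  · intro φ ψ hφψ
    exact hS.hom_ext_right (congrArg (fun f : LinearMap.ker (dualD P C (k + 1)) => f.1.hom) hφψ)
  · rintro ⟨f, hf⟩
    obtain ⟨φ, hφ⟩ := hS.exists_desc f.hom (LinearMap.ext (by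
      rintro ⟨_, x, rfl⟩
      exact LinearMap.congr_fun (congrArg ModuleCat.Hom.hom hf) x))
    exact ⟨φ, Subtype.ext (ModuleCat.hom_ext hφ)⟩

variable {P C}

lemma bidualityLift_eq (n : ℕ) (h : ∀ i < n + 1, Subsingleton (Abelian.Ext M C i))
    (p : P.complex.X 0) :
    bidualityLift P C n h p =
      (isSES_ext P C n).shortExact.extClass.comp (yonedaEval P C n h p) (add_comm 1 n) := by
  rw [bidualityLift_apply, yonedaExtClass, Abelian.Ext.comp_assoc_of_third_deg_zero]
  rfl

/-- If the image of `P_{n+1}` in `P_n` is totally reflexive, then the dual of the cocycles is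
computed by evaluations. -/
lemma exists_evalAt_cocycle {n : ℕ}
    (hS : TotRefl C (LinearMap.range (P.complex.d (n + 1) n).hom))
    (ψ : LinearMap.ker (dualD P C (n + 1)) →ₗ[R] C) :
    ∃ q, ψ ∘ₗ boundaryToCocycle P C n =
      evalAt P C (n + 1) q ∘ₗ (LinearMap.range (dualD P C n)).subtype := by
  obtain ⟨e, he⟩ := exists_cocycle_equiv P C n
  obtain ⟨⟨_, q, rfl⟩, hq⟩ := hS.bijective.2 (ψ ∘ₗ e.toLinearMap)
  refine ⟨q, LinearMap.ext fun f => ?_⟩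
  obtain ⟨φ, hφ⟩ := e.surjective (boundaryToCocycle P C n f)
  change ψ _ = (boundaryToCocycle P C n f).1.hom q
  rw [← hφ, he]
  exact (LinearMap.congr_fun hq φ).symm

lemma extVanish_syzygy (k : ℕ) {l : ℕ} (hl : 0 < l)
    (h : ExtVanish (R := R) M C (l + k + 1)) :
    ExtVanish (R := R) (LinearMap.range (P.complex.d (k + 1) k).hom) C l := by
  have hproj : ∀ j, ExtVanish (R := R) (P.complex.X j) C l := fun j =>
    have : Module.Projective R (P.complex.X j) :=
      (IsProjective.iff_projective (R := R) (P.complex.X j)).2 (P.projective j)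
    extVanish_of_projective hl
  induction k generalizing l with
  | zero => exact (isSES_augmentation P).ext_left (hproj 0) h
  | succ k ih =>
    refine (isSES_syzygy P k).ext_left (hproj (k + 1)) (ih l.succ_pos ?_ fun j => ?_)
    · rwa [show l + 1 + k + 1 = l + (k + 1) + 1 by omega]
    · have : Module.Projective R (P.complex.X j) :=
        (IsProjective.iff_projective (R := R) (P.complex.X j)).2 (P.projective j)
      exact extVanish_of_projective l.succ_pos

variable (hP : ∀ k, TotRefl C (P.complex.X k))
include hP

/-- The cocycles are the dual of the syzygy, so they have no higher `Ext` into `C`. The last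
connecting map is thus onto, and the kernel of the lift of `δ` to `P_0` is the image of `P_1`. -/
lemma biduality_bijective {n : ℕ} (h : ∀ i < n + 1, Subsingleton (Abelian.Ext M C i))
    (hS : TotRefl C (LinearMap.range (P.complex.d (n + 1) n).hom)) :
    Function.Bijective (biduality P C (n + 1) h) := by
  obtain ⟨e, -⟩ := exists_cocycle_equiv P C n
  have hZ : ∀ l, 0 < l → ExtVanish (R := R) (LinearMap.ker (dualD P C (n + 1))) C l :=
    fun l hl => (hS.dual_ext_eq_zero l hl).congr e
  constructor
  · refine (injective_iff_map_eq_zero _).2 fun m hm => ?_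
    obtain ⟨p, rfl⟩ := augmentation_surjective P m
    rw [biduality_augmentation, bidualityLift_eq] at hm
    obtain ⟨q, rfl⟩ := mem_range_of_extClass_comp_yonedaEval_eq_zero hP n h (isSES_ext P C n)
      (hZ n) (exists_evalAt_cocycle hS) p hm
    exact (augmentation_exact P).apply_apply_eq_zero q
  · intro x
    obtain ⟨y, rfl⟩ := Abelian.Ext.contravariant_sequence_exact₃ (isSES_ext P C n).shortExact C x
      ((hZ _ n.succ_pos).elim _ _) (add_comm 1 n)
    obtain ⟨p, rfl⟩ := exists_yonedaEval_eq hP n h y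
    exact ⟨augmentation P p, by rw [biduality_augmentation, bidualityLift_eq]⟩

lemma extVanish_ext {n : ℕ} (h : ∀ i < n + 1, Subsingleton (Abelian.Ext M C i))
    (hS : TotRefl C (LinearMap.range (P.complex.d (n + 1) n).hom)) {i : ℕ} (hi : 0 < i) :
    ExtVanish (R := R) (Abelian.Ext M C (n + 1)) C (n + 1 + i) := by
  obtain ⟨e, -⟩ := exists_cocycle_equiv P C n
  rw [show n + 1 + i = n + i + 1 by omega]
  exact (isSES_ext P C n).ext_right (extVanish_range_dualD hP n h (by omega) (by omega))
    ((hS.dual_ext_eq_zero _ (n + i).succ_pos).congr e)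

/-- With `E = Ext^{n+1}(M, C)`, the sequence `0 → im d^n → S^* → E → 0` has only two interesting
degrees, `n` and `n + 1`, where bijectivity of `δ` makes the connecting map cancel the surviving
groups. Reflexivity of `S` then follows from `Hom(E, C) = 0`. -/
lemma totRefl_syzygy [IsNoetherianRing R] {n : ℕ}
    (h : ∀ i < n + 1, Subsingleton (Abelian.Ext M C i))
    (h' : ∀ i, n + 1 < i → Subsingleton (Abelian.Ext M C i))
    (hE : ∀ i, i ≠ n + 1 → ExtVanish (R := R) (Abelian.Ext M C (n + 1)) C i)
    (hbij : Function.Bijective (biduality P C (n + 1) h)) :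
    TotRefl C (LinearMap.range (P.complex.d (n + 1) n).hom) := by
  obtain ⟨e, he⟩ := exists_cocycle_equiv P C n
  have hS := isSES_ext P C n
  have hfin := (hP n).finite
  have hker : ∀ p, hS.shortExact.extClass.comp (yonedaEval P C n h p) (add_comm 1 n) = 0 →
      p ∈ LinearMap.range (P.complex.d 1 0).hom := by
    intro p hp
    have : augmentation P p = 0 := hbij.1 (by
      rw [biduality_augmentation, bidualityLift_eq, hp, map_zero])
    exact (augmentation_exact P p).1 this
  have hE0 := extVanish_zero_iff.1 (hE 0 (by omega))
  refine ⟨inferInstance, fun i hi => extVanish_syzygy n hi (h' _ (by omega)), fun i hi => ?_,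
    ?_, fun ψ => ?_⟩
  · refine ExtVanish.congr e.symm ?_
    -- In degree `n + 1` surjectivity of `δ` is used: every class on `Ext^{n+1}(M, C)` is a
    -- connecting image, so it dies on the cocycles.
    by_cases h1 : i = n + 1
    · subst h1
      refine subsingleton_of_forall_eq 0 fun x => ?_
      obtain ⟨y, rfl⟩ := Abelian.Ext.contravariant_sequence_exact₂ hS.shortExact C x
        ((extVanish_range_dualD hP n h n.succ_pos (by omega)).elim _ _)
      obtain ⟨m, rfl⟩ := hbij.2 y
      obtain ⟨p, rfl⟩ := augmentation_surjective P m
      rw [biduality_augmentation, bidualityLift_eq]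
      exact hS.shortExact.comp_extClass_assoc _ (add_comm 1 n)
    · by_cases h2 : i = n
      · subst h2
        refine subsingleton_of_forall_eq 0 fun x => ?_
        -- In degree `n` injectivity of `δ` is used: the restriction to `im d^n` comes from some `p`
        -- with zero connecting image, so `p` is a boundary and the restriction vanishes.
        obtain ⟨y, rfl⟩ := Abelian.Ext.contravariant_sequence_exact₂ hS.shortExact C x (by
          obtain ⟨p, hp⟩ := exists_yonedaEval_eq hP i h
            ((Abelian.Ext.mk₀ hS.sc.f).comp x (zero_add i))
          rw [← hp]
          obtain ⟨q, rfl⟩ := hker p (by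
            rw [hp]
            exact hS.shortExact.extClass_comp_assoc _)
          exact yonedaEval_d hi h q)
        rw [(hE i h1).elim y 0, Abelian.Ext.comp_zero]
      · exact hS.ext_mid (extVanish_range_dualD hP n h hi h2) (hE i h1)
  · refine (injective_iff_map_eq_zero _).2 fun s hs => ?_
    -- Functionals on `P_n` restricted to the syzygy already separate its elements.
    refine Subtype.ext ((hP n).bijective.1 (LinearMap.ext fun φ => ?_))
    exact (LinearMap.congr_fun hs (φ ∘ₗ Submodule.subtype _)).trans (map_zero φ).symm
  · obtain ⟨q, hq⟩ : ∃ q, (ψ ∘ₗ e.symm.toLinearMap) ∘ₗ boundaryToCocycle P C n =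
        evalAt P C (n + 1) q ∘ₗ (LinearMap.range (dualD P C n)).subtype := by
      cases n with
      | zero =>
        obtain ⟨p, hp⟩ := (evalRange_bijective hP (h 0 one_pos)).2
          ((ψ ∘ₗ e.symm.toLinearMap) ∘ₗ boundaryToCocycle P C 0)
        obtain ⟨q, rfl⟩ := hker p (by
          change hS.shortExact.extClass.comp ((Abelian.Ext.mk₀ (𝟙 _)).comp
            (Abelian.Ext.mk₀ (ModuleCat.ofHom (evalRange P C (h 0 one_pos) p))) _) _ = 0
          rw [hp, Abelian.Ext.mk₀_id_comp]
          have : ModuleCat.ofHom ((ψ ∘ₗ e.symm.toLinearMap) ∘ₗ boundaryToCocycle P C 0) =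
            hS.sc.f ≫ ModuleCat.ofHom (ψ ∘ₗ e.symm.toLinearMap) := rfl
          rw [this, ← Abelian.Ext.mk₀_comp_mk₀]
          exact hS.shortExact.extClass_comp_assoc _)
        exact ⟨q, by rw [← hp, evalRange_d]⟩
      | succ n => exact exists_evalAt_eq hP n _
    refine ⟨(P.complex.d (n + 1) n).hom.rangeRestrict q, LinearMap.ext fun φ => ?_⟩
    let ev : LinearMap.ker (dualD P C (n + 1)) →ₗ[R] C :=
      evalAt P C (n + 1) q ∘ₗ (LinearMap.ker (dualD P C (n + 1))).subtype
    -- The difference from evaluation at `q` vanishes on coboundaries, so it factors through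
    -- `Ext^{n+1}(M, C)`, which has no nonzero map to `C`.
    obtain ⟨θ, hθ⟩ := hS.exists_desc (ψ ∘ₗ e.symm.toLinearMap - ev) (by
      rw [LinearMap.sub_comp, hq]
      exact sub_self _)
    rw [Subsingleton.elim θ 0, LinearMap.zero_comp] at hθ
    have := LinearMap.congr_fun (sub_eq_zero.1 hθ.symm) (e φ)
    change ψ (e.symm (e φ)) = (e φ).1.hom q at this
    rw [e.symm_apply_apply, he] at this
    exact this.symm

end

end GCDim

namespace GCDim

variable {R : Type u} [CommRing R]

/-! ### The classes `𝒢_C^g` and finite `C`-Gorenstein dimension -/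

lemma extVanish_of_lt_grade {M : ModuleCat.{u} R} {l : ℕ} (h : (l : ℕ∞) < grade M) :
    Subsingleton (Abelian.Ext M (ModuleCat.of R R) l) := by
  by_contra hn
  rw [not_subsingleton_iff_nontrivial] at hn
  exact absurd (iInf₂_le l hn : grade M ≤ l) (not_le.2 h)

lemma grade_eq_of_extVanish {M : ModuleCat.{u} R} {n : ℕ}
    (h : ∀ l < n, Subsingleton (Abelian.Ext M (ModuleCat.of R R) l))
    (hn : Nontrivial (Abelian.Ext M (ModuleCat.of R R) n)) : grade M = n := by
  refine le_antisymm (iInf₂_le n hn) (le_iInf₂ fun l hl => ?_)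
  by_contra hlt
  rw [not_le, Nat.cast_lt] at hlt
  exact not_subsingleton _ (h l hlt)

lemma annihilator_le_annihilator_ext (M N : ModuleCat.{u} R) (n : ℕ) :
    Module.annihilator R M ≤ Module.annihilator R (Abelian.Ext M N n) := by
  intro r hr
  refine Module.mem_annihilator.2 fun x => ?_
  have h : r • 𝟙 M = 0 := ModuleCat.hom_ext (LinearMap.ext (Module.mem_annihilator.1 hr))
  rw [← Abelian.Ext.mk₀_id_comp x, ← Abelian.Ext.smul_comp, ← Abelian.Ext.mk₀_smul, h,
    Abelian.Ext.mk₀_zero, Abelian.Ext.zero_comp]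

variable {C : ModuleCat.{u} R}

/-- `Ext^0(M, C) ≅ Hom(M, C)`. -/
noncomputable def extZeroEquiv (M C : ModuleCat.{u} R) : Abelian.Ext M C 0 ≃ₗ[R] (M →ₗ[R] C) :=
  (Abelian.Ext.linearEquiv₀ (R := R)).trans (ModuleCat.homLinearEquiv (S := R))

lemma delta_zero_bijective_iff (M : ModuleCat.{u} R)
    (h : ∀ i < 0, Subsingleton (Abelian.Ext M C i)) :
    Function.Bijective (delta C 0 M h) ↔ Function.Bijective (bidualMap C M) := by
  have : ⇑(delta C 0 M h) = ((extZeroEquiv M C).symm.congrLeft C R).trans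
      (extZeroEquiv (ModuleCat.of R (Abelian.Ext M C 0)) C).symm ∘ bidualMap C M := rfl
  rw [this]
  exact (LinearEquiv.bijective _).of_comp_iff' _

section syzygy

variable [IsNoetherianRing R] {M : ModuleCat.{u} R} (P : ProjectiveResolution M)
  (hC : IsSemidualizing C) (hP : ∀ k, TotRefl C (P.complex.X k))
include hC hP

lemma HasFinDim.syzygy (hM : HasFinDim C M) (k : ℕ) :
    HasFinDim C (LinearMap.range (P.complex.d (k + 1) k).hom) := by
  induction k with
  | zero => exact (isSES_augmentation P).hasFinDim_left hC (hP 0).hasFinDim hM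
  | succ k ih => exact (isSES_syzygy P k).hasFinDim_left hC (hP _).hasFinDim ih

lemma HasFinDim.of_syzygy (k : ℕ)
    (h : HasFinDim C (LinearMap.range (P.complex.d (k + 1) k).hom)) : HasFinDim C M := by
  induction k with
  | zero => exact (isSES_augmentation P).hasFinDim_right hC h (hP 0).hasFinDim
  | succ k ih => exact ih ((isSES_syzygy P k).hasFinDim_right hC h (hP _).hasFinDim)

end syzygy

/-! ### Comparing `𝒢_C^j` with finite totally reflexive resolutions -/

lemma exists_totRefl_resolution [IsNoetherianRing R] (hC : IsSemidualizing C)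
    (M : ModuleCat.{u} R) [Module.Finite R M] :
    ∃ P : ProjectiveResolution M, ∀ k, TotRefl C (P.complex.X k) := by
  obtain ⟨P, hP⟩ := exists_freeResolution M
  refine ⟨P, fun k => ?_⟩
  obtain ⟨m, ⟨e⟩⟩ := hP k
  exact (hC.totRefl_pi m).congr e

theorem IsGCZero.hasFinDim [IsNoetherianRing R] (hC : IsSemidualizing C) {g : ℕ}
    {M : ModuleCat.{u} R} (h : IsGCZero C g M) : HasFinDim C M := by
  have := h.finite
  have := hC.finite
  obtain ⟨h₀, hbij⟩ := h.delta_bijective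
  cases g with
  | zero =>
    refine TotRefl.hasFinDim ⟨h.finite, fun i hi => ?_, fun i hi => ?_,
      (delta_zero_bijective_iff M h₀).1 hbij⟩
    · have := h.ext_eq_zero i hi
      rwa [zero_add] at this
    · have := h.ext_ext_eq_zero i hi
      rw [zero_add] at this
      exact ExtVanish.congr (extZeroEquiv M C) this
  | succ n =>
    obtain ⟨P, hP⟩ := exists_totRefl_resolution hC M
    refine HasFinDim.of_syzygy P hC hP n (totRefl_syzygy hP h₀ (fun i hi => ?_) (fun i hi => ?_)
      ?_).hasFinDim
    · have := h.ext_eq_zero (i - (n + 1)) (by omega)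
      rwa [Nat.add_sub_cancel' hi.le] at this
    · rcases lt_or_gt_of_ne hi with hi | hi
      -- Below degree `n + 1` the vanishing is a matter of annihilators: whatever kills `M` kills
      -- `Ext^{n+1}(M, C)`.
      · exact extVanish_of_annihilator_le (annihilator_le_annihilator_ext M C (n + 1)) (n + 1) C
          h₀ i hi
      · have := h.ext_ext_eq_zero (i - (n + 1)) (by omega)
        rwa [Nat.add_sub_cancel' hi.le] at this
    · rw [biduality_eq C P (projectiveResolution M)]
      exact hbij

/-- Being killed by `J` gives grade at least `g`, and the nonzero map to `T` gives equality. The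
`g`-th syzygy has finite dimension and no higher `Ext` into `C`, so it is totally reflexive. -/
theorem IsPerfectQuotient.isGCZero [IsNoetherianRing R] (hC : IsSemidualizing C) {J : Ideal R}
    {g : ℕ} {T : Type u} [AddCommGroup T] [Module R T] (hT : IsPerfectQuotient C J g T)
    {K : Type u} [AddCommGroup K] [Module R K]
    (hK : J ≤ Module.annihilator R K) (hKT : Nontrivial (K →ₗ[R] T)) (hfin : HasFinDim C K)
    (hext : ∀ l, g < l → ExtVanish (R := R) K C l) : IsGCZero C g (ModuleCat.of R K) := by
  have := hfin.finite
  have hgrade : grade (ModuleCat.of R K) = g :=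
    grade_eq_of_extVanish (hT.ext_self_eq_zero K hK) (hT.nontrivial_ext K hK hKT)
  have h₀ := hT.ext_dualizing_eq_zero K hK
  cases g with
  | zero =>
    have hK' := hfin.totRefl hext
    refine ⟨hfin.finite, hgrade, fun i hi => ?_, fun i hi => ?_, h₀,
      (delta_zero_bijective_iff (ModuleCat.of R K) h₀).2 hK'.bijective⟩
    · rw [zero_add]
      exact hext i hi
    · rw [zero_add]
      exact (hK'.dual_ext_eq_zero i hi).congr (extZeroEquiv (ModuleCat.of R K) C).symm
  | succ n =>
    obtain ⟨P, hP⟩ := exists_totRefl_resolution hC (ModuleCat.of R K)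
    have hS := (HasFinDim.syzygy P hC hP hfin n).totRefl
      fun l hl => extVanish_syzygy n hl (hext _ (by omega))
    refine ⟨hfin.finite, hgrade, fun i hi => hext _ (by omega),
      fun i hi => extVanish_ext hP h₀ hS hi, h₀, ?_⟩
    rw [delta, biduality_eq C (projectiveResolution (ModuleCat.of R K)) P]
    exact biduality_bijective hP h₀ hS

/-! ### `G_C^g`-resolutions -/

namespace GCResolution

variable {j : ℕ}

/-- A module isomorphic to a module in `𝒢_C^j` has a `G_C^j`-resolution of length `0`. -/
def ofEquiv {X : ModuleCat.{u} R} (hX : IsGCZero C j X) {M : ModuleCat.{u} R} (e : X ≃ₗ[R] M) :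
    GCResolution C j M 0 where
  X
    | 0 => X
    | _ + 1 => ModuleCat.of R PUnit
  d _ := 0
  ε := e.toLinearMap
  surjective := e.surjective
  exact_zero x := by
    refine ⟨fun h => ⟨0, ?_⟩, ?_⟩
    · rw [map_zero]
      exact (e.map_eq_zero_iff.1 h).symm
    · rintro ⟨_, rfl⟩
      exact map_zero _
  exact_succ k x := ⟨fun _ => ⟨0, Subsingleton.elim (α := PUnit) _ _⟩, fun _ => rfl⟩
  isGCZero k hk := by
    obtain rfl := Nat.le_zero.1 hk
    exact hX
  eq_zero
    | 0, hk => absurd hk (lt_irrefl 0)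
    | _ + 1, _ => inferInstanceAs (Subsingleton PUnit)

/-- Splicing a resolution of the kernel of a surjection `X → M`, with `X` in `𝒢_C^j`. -/
def cons {X M : ModuleCat.{u} R} (hX : IsGCZero C j X) (f : X →ₗ[R] M)
    (hf : Function.Surjective f) {n : ℕ}
    (r : GCResolution C j (ModuleCat.of R (LinearMap.ker f)) n) : GCResolution C j M (n + 1) where
  X
    | 0 => X
    | k + 1 => r.X k
  d
    | 0 => (LinearMap.ker f).subtype ∘ₗ r.ε
    | k + 1 => r.d k
  ε := f
  surjective := hf
  exact_zero x := by
    constructor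
    · intro hx
      obtain ⟨y, hy⟩ := r.surjective ⟨x, hx⟩
      exact ⟨y, congrArg Subtype.val hy⟩
    · rintro ⟨y, rfl⟩
      exact (r.ε y).2
  exact_succ
    | 0 => fun x => by
      refine Iff.trans ?_ (r.exact_zero x)
      exact ⟨fun h => Subtype.ext h, fun h => congrArg Subtype.val h⟩
    | k + 1 => r.exact_succ k
  isGCZero
    | 0, _ => hX
    | k + 1, hk => r.isGCZero k (Nat.le_of_succ_le_succ hk)
  eq_zero
    | 0, hk => absurd hk (Nat.not_lt_zero _)
    | k + 1, hk => r.eq_zero k (Nat.lt_of_succ_lt_succ hk)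

/-- The resolution of the kernel of the augmentation. -/
def tail {M : ModuleCat.{u} R} {n : ℕ} (r : GCResolution C j M (n + 1)) :
    GCResolution C j (ModuleCat.of R (LinearMap.ker r.ε)) n where
  X k := r.X (k + 1)
  d k := r.d (k + 1)
  ε := (r.d 0).codRestrict (LinearMap.ker r.ε) r.exact_zero.apply_apply_eq_zero
  surjective y := by
    obtain ⟨x, hx⟩ := (r.exact_zero y.1).1 y.2
    exact ⟨x, Subtype.ext hx⟩
  exact_zero x := by
    refine Iff.trans ?_ (r.exact_succ 0 x)
    exact ⟨fun h => congrArg Subtype.val h, fun h => Subtype.ext h⟩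
  exact_succ k := r.exact_succ (k + 1)
  isGCZero k hk := r.isGCZero (k + 1) (Nat.succ_le_succ hk)
  eq_zero k hk := r.eq_zero (k + 1) (Nat.succ_lt_succ hk)

theorem hasFinDim [IsNoetherianRing R] (hC : IsSemidualizing C) {n : ℕ} {M : ModuleCat.{u} R}
    (r : GCResolution C j M n) : HasFinDim C M := by
  have h0 := (r.isGCZero 0 n.zero_le).hasFinDim hC
  induction n generalizing M with
  | zero =>
    have := r.eq_zero 1 one_pos
    refine h0.congr (LinearEquiv.ofBijective r.ε ⟨(injective_iff_map_eq_zero _).2 fun x hx => ?_,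
      r.surjective⟩)
    obtain ⟨y, rfl⟩ := (r.exact_zero x).1 hx
    rw [Subsingleton.elim y 0, map_zero]
  | succ n ih =>
    exact (isSES_ker r.surjective).hasFinDim_right hC
      (ih r.tail ((r.tail.isGCZero 0 n.zero_le).hasFinDim hC)) h0

end GCResolution

lemma gcDim_lt_top_iff {j : ℕ} {M : ModuleCat.{u} R} :
    gcDim C j M < ⊤ ↔ ∃ n, Nonempty (GCResolution C j M n) := by
  simp [gcDim, iInf_lt_iff]

lemma nontrivial_hom_of_injective {K T : Type*} [AddCommGroup K] [Module R K] [AddCommGroup T]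
    [Module R T] [Nontrivial K] {m : ℕ} {f : K →ₗ[R] (Fin m → T)} (hf : Function.Injective f) :
    Nontrivial (K →ₗ[R] T) := by
  obtain ⟨k, hk⟩ := exists_ne (0 : K)
  obtain ⟨a, ha⟩ := Function.ne_iff.1 (fun h => hk (hf (h.trans (map_zero f).symm)))
  exact ⟨LinearMap.proj a ∘ₗ f, 0, fun h => ha (LinearMap.congr_fun h k)⟩

namespace IsPerfectQuotient

variable {J : Ideal R} {g : ℕ} {T : Type u} [AddCommGroup T] [Module R T]
  (hT : IsPerfectQuotient C J g T)
include hT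

lemma le_annihilator_pi (m : ℕ) : J ≤ Module.annihilator R (Fin m → T) := fun _ hr =>
  Module.mem_annihilator.2 fun x => funext fun a =>
    Module.mem_annihilator.1 (hT.le_annihilator hr) (x a)

lemma extVanish_pi (m : ℕ) {l : ℕ} (hl : g < l) : ExtVanish (R := R) (Fin m → T) C l := by
  induction m with
  | zero => exact extVanish_of_subsingleton l
  | succ m ih =>
    exact ((isSES_prod T (Fin m → T)).ext_mid (hT.ext_eq_zero l hl) ih).congr
      (Fin.consLinearEquiv R (fun _ : Fin (m + 1) => T))

variable [IsNoetherianRing R] (hC : IsSemidualizing C)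
include hC

lemma hasFinDim_pi (m : ℕ) : HasFinDim C (Fin m → T) := by
  induction m with
  | zero => exact totRefl_of_subsingleton.hasFinDim
  | succ m ih =>
    exact ((isSES_prod T (Fin m → T)).hasFinDim_mid hC hT.hasFinDim ih).congr
      (Fin.consLinearEquiv R (fun _ : Fin (m + 1) => T))

/-- Here `b` measures how far `Ext(K, C)` may survive beyond degree `g`; passing to the kernel of a
cover by a power of `T` lowers it by one. The map to `T` is needed only at the end, and kernels have
one because they embed in a power of `T`. -/
lemma exists_gcResolution (b : ℕ) (K : Type u) [AddCommGroup K] [Module R K] [Nontrivial K]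
    (hK : J ≤ Module.annihilator R K) (hfin : HasFinDim C K)
    (hext : ∀ l, g + b < l → ExtVanish (R := R) K C l)
    (hKT : b = 0 → Nontrivial (K →ₗ[R] T)) :
    ∃ n, Nonempty (GCResolution C g (ModuleCat.of R K) n) := by
  induction b generalizing K with
  | zero =>
    exact ⟨0, ⟨GCResolution.ofEquiv (hT.isGCZero hC hK (hKT rfl) hfin hext)
      (LinearEquiv.refl R K)⟩⟩
  | succ b ih =>
    have := hfin.finite
    obtain ⟨m, f, hf⟩ := hT.exists_surjective K hK
    have hnt : Nontrivial (Fin m → T) := hf.nontrivial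
    have hX : IsGCZero C g (ModuleCat.of R (Fin m → T)) :=
      hT.isGCZero hC (hT.le_annihilator_pi m)
        (nontrivial_hom_of_injective (f := LinearMap.id) Function.injective_id)
        (hT.hasFinDim_pi hC m) fun l hl => hT.extVanish_pi m hl
    -- A zero kernel has grade `⊤` and is not in `𝒢_C^g`, so the resolution stops here.
    rcases subsingleton_or_nontrivial (LinearMap.ker f) with hker | hker
    · exact ⟨0, ⟨GCResolution.ofEquiv hX (LinearEquiv.ofBijective f
        ⟨LinearMap.ker_eq_bot.1 (Submodule.subsingleton_iff_eq_bot.1 hker), hf⟩)⟩⟩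
    · obtain ⟨n, ⟨r⟩⟩ := ih (LinearMap.ker f)
        (fun a ha => Module.mem_annihilator.2 fun x => Subtype.ext
          (Module.mem_annihilator.1 (hT.le_annihilator_pi m ha) x.1))
        ((isSES_ker hf).hasFinDim_left hC (hT.hasFinDim_pi hC m) hfin)
        (fun l hl => (isSES_ker hf).ext_left (hT.extVanish_pi m (by omega)) (hext _ (by omega)))
        (fun _ => nontrivial_hom_of_injective (f := (LinearMap.ker f).subtype)
          Subtype.val_injective)
      exact ⟨n + 1, ⟨GCResolution.cons hX f hf r⟩⟩

end IsPerfectQuotient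

/-- For `i ≤ grade M`, the `G_C^i`-dimension of `M` is finite if and only if `M` has finite
`C`-Gorenstein dimension. -/
theorem gcDim_lt_top_iff_hasFinDim [IsNoetherianRing R] (hC : IsSemidualizing C)
    (M : ModuleCat.{u} R) [Module.Finite R M] [Nontrivial M] {i : ℕ} (hi : (i : ℕ∞) ≤ grade M) :
    gcDim C i M < ⊤ ↔ HasFinDim C M := by
  rw [gcDim_lt_top_iff]
  refine ⟨fun ⟨_, ⟨r⟩⟩ => r.hasFinDim hC, fun ⟨b, hb⟩ => ?_⟩
  obtain ⟨J, T, hJ, hT⟩ := exists_isPerfectQuotient hC M i fun l hl =>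
    extVanish_of_lt_grade ((Nat.cast_lt.2 hl).trans_le hi)
  -- Starting from `b + 1` forces at least one cover: `M` itself may have no nonzero map to `T`, for
  -- instance when its grade exceeds `i`.
  exact hT.exists_gcResolution hC (b + 1) M hJ ⟨b, hb⟩ (fun l hl => hb.extVanish (by omega))
    (fun h => absurd h b.succ_ne_zero)

lemma nontrivial_of_grade_ne_top {M : ModuleCat.{u} R} (h : grade M ≠ ⊤) : Nontrivial M := by
  by_contra hn
  rw [not_nontrivial_iff_subsingleton] at hn
  refine h (iInf₂_eq_top.2 fun i hi => ?_)
  exact absurd (extVanish_of_subsingleton (R := R) (M := M) i) (not_subsingleton_iff_nontrivial.2 hi)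

end GCDim

theorem theorem2 {R : Type u} [CommRing R] [IsNoetherianRing R]
    (C : ModuleCat.{u} R) (hC : GCDim.IsSemidualizing C)
    (M : ModuleCat.{u} R) [Module.Finite R M]
    (g : ℕ) (hg : GCDim.grade M = (g : ℕ∞)) (i : ℕ) (hi : i ≤ g) :
    GCDim.gcDim C i M < ⊤ ↔ GCDim.gcDim C g M < ⊤ := by
  have : Nontrivial M := GCDim.nontrivial_of_grade_ne_top (hg ▸ ENat.natCast_ne_top g)
  rw [GCDim.gcDim_lt_top_iff_hasFinDim hC M (hg.ge.trans' (Nat.cast_le.2 hi)),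
    GCDim.gcDim_lt_top_iff_hasFinDim hC M hg.ge]
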